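/- Consider unlabelled, rooted, non-plane binary trees: a tree is either a single external node, or a root to which an unordered pair of (not necessarily distinct) trees is attached. The size of a tree is its number of external nodes, and its height is the maximal number of edges on a path from the root to an external node. Let $y_n$ be the number of trees of size $n$, let $y_{h,n}$ be the number of those of height at most $h$, and let $\rho$ be the radius of convergence of $\sum_{n\ge1} y_n z^n$. For $r_0,\theta_0>0$ define the sandclock $$\mathcal S(r_0,\theta_0)=\{z\in\mathbb C:\ |z-\rho|<r_0,\ \pi/2-\theta_0<|\arg(z-\rho)|<\pi/2+\theta_0\}.$$ **Proposition (main estimate for $e_h$ in a sandclock).** There are $\varepsilon>0$ and $\varphi\in(0,\pi/2)$ such that $y(z)=\sum_{n\ge1}y_nz^n$ continues analytically from the disc $|z|<\rho$ to the domain $\Delta=\{z:\ |z|<\rho+\varepsilon,\ z\ne\rho,\ |\arg(z-\rho)|>\varphi\}$; write $y=y(z)$ for this continuation, $y_h(z)=\sum_{n\ge1}y_{h,n}z^n$ (a polynomial) and $e_h=e_h(z)=y(z)-y_h(z)$. There exist $r_1>0$, $\theta_1\in(0,\pi/2)$ and $K,K'>0$ such that $\mathcal S(r_1,\theta_1)\subseteq\Delta$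 and, for all $z\in\mathcal S(r_1,\theta_1)$ and all integers $h\ge1$, one has $|y|<1$, $e_h(z)\neq0$ and $$\frac{y^h}{e_h}=\frac12\,\frac{1-y^h}{1-y}+R_h(z),\qquad\text{where}\quad |R_h(z)|\le K\min\Big\{\log\frac1{1-|y|},\ \log(1+h)\Big\}.$$ Furthermore, $|R_h(z)-R_{h+1}(z)|<K'/h$ for all such $z$ and $h$. -/

import Mathlib

noncomputable section

namespace NonPlaneTree

/-- Two plane binary trees (`nil` is an external node, `node` is an internal node with an ordered
pair of subtrees) represent the same non-plane tree: one is obtained from the other by exchanging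
the two subtrees at some of the internal nodes. -/
inductive SwapEquiv : BinaryTree Unit → BinaryTree Unit → Prop
  | nil : SwapEquiv .nil .nil
  | node {a b a' b' : BinaryTree Unit} :
      SwapEquiv a a' → SwapEquiv b b' → SwapEquiv (.node () a b) (.node () a' b')
  | swap {a b a' b' : BinaryTree Unit} :
      SwapEquiv a b' → SwapEquiv b a' → SwapEquiv (.node () a b) (.node () a' b')

theorem SwapEquiv.refl : ∀ t : BinaryTree Unit, SwapEquiv t t
  | .nil => .nil
  | .node _ a b => .node (SwapEquiv.refl a) (SwapEquiv.refl b)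

theorem SwapEquiv.symm {s t : BinaryTree Unit} (h : SwapEquiv s t) : SwapEquiv t s := by
  induction h with
  | nil => exact .nil
  | node _ _ h₁ h₂ => exact .node h₁ h₂
  | swap _ _ h₁ h₂ => exact .swap h₂ h₁

theorem SwapEquiv.trans {s t u : BinaryTree Unit} (h : SwapEquiv s t) (k : SwapEquiv t u) :
    SwapEquiv s u := by
  induction h generalizing u with
  | nil => exact k
  | node _ _ h₁ h₂ =>
    cases k with
    | node k₁ k₂ => exact .node (h₁ k₁) (h₂ k₂)
    | swap k₁ k₂ => exact .swap (h₁ k₁) (h₂ k₂)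
  | swap _ _ h₁ h₂ =>
    cases k with
    | node k₁ k₂ => exact .swap (h₁ k₂) (h₂ k₁)
    | swap k₁ k₂ => exact .node (h₁ k₂) (h₂ k₁)

theorem SwapEquiv.numLeaves_eq {s t : BinaryTree Unit} (h : SwapEquiv s t) :
    s.numLeaves = t.numLeaves := by
  induction h with
  | nil => rfl
  | node _ _ h₁ h₂ => simp only [BinaryTree.numLeaves]; omega
  | swap _ _ h₁ h₂ => simp only [BinaryTree.numLeaves]; omega

theorem SwapEquiv.height_eq {s t : BinaryTree Unit} (h : SwapEquiv s t) :
    s.height = t.height := by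
  induction h with
  | nil => rfl
  | node _ _ h₁ h₂ => simp only [BinaryTree.height]; omega
  | swap _ _ h₁ h₂ => simp only [BinaryTree.height]; omega

/-- The equivalence relation whose classes are the non-plane binary trees. -/
def swapSetoid : Setoid (BinaryTree Unit) :=
  ⟨SwapEquiv, ⟨SwapEquiv.refl, SwapEquiv.symm, SwapEquiv.trans⟩⟩

/-- Unlabelled rooted non-plane binary trees. -/
def NPTree : Type := Quotient swapSetoid

/-- The size of a tree: its number of external nodes. -/
def NPTree.size (t : NPTree) : ℕ :=
  Quotient.lift BinaryTree.numLeaves (fun _ _ h => SwapEquiv.numLeaves_eq h) t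

/-- The height of a tree: the maximal number of edges from the root to an external node
(the tree consisting of one external node has height `0`). -/
def NPTree.height (t : NPTree) : ℕ :=
  Quotient.lift BinaryTree.height (fun _ _ h => SwapEquiv.height_eq h) t

/-- `y_n`: the number of trees of size `n`. -/
def treeCount (n : ℕ) : ℕ := Nat.card {t : NPTree // t.size = n}

/-- `y_{h,n}`: the number of trees of size `n` and height at most `h`. -/
def treeCountLE (h n : ℕ) : ℕ := Nat.card {t : NPTree // t.size = n ∧ t.height ≤ h}

theorem numLeaves_le (t : BinaryTree Unit) : t.numLeaves ≤ 2 ^ t.height := by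
  induction t with
  | nil => simp [BinaryTree.numLeaves, BinaryTree.height]
  | node v a b ha hb =>
    simp only [BinaryTree.numLeaves, BinaryTree.height, pow_succ]
    have h₁ : 2 ^ a.height ≤ 2 ^ max a.height b.height :=
      Nat.pow_le_pow_right (by norm_num) (le_max_left _ _)
    have h₂ : 2 ^ b.height ≤ 2 ^ max a.height b.height :=
      Nat.pow_le_pow_right (by norm_num) (le_max_right _ _)
    omega

/-- A tree of height at most `h` has size at most `2 ^ h`. -/
theorem treeCountLE_eq_zero {h n : ℕ} (hn : 2 ^ h < n) : treeCountLE h n = 0 := by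
  have : IsEmpty {t : NPTree // t.size = n ∧ t.height ≤ h} := by
    refine ⟨fun ⟨t, hs, hh⟩ => ?_⟩
    induction t using Quotient.inductionOn with
    | h t =>
      have h₁ : t.numLeaves = n := hs
      have h₂ : t.height ≤ h := hh
      have h₃ := numLeaves_le t
      have h₄ : 2 ^ t.height ≤ 2 ^ h := Nat.pow_le_pow_right (by norm_num) h₂
      omega
  exact Nat.card_of_isEmpty

/-- The generating function `y_h(z) = ∑ y_{h,n} z ^ n` of trees of height at most `h`. It is a
polynomial, since `y_{h,n} = 0` for `n > 2 ^ h` by `treeCountLE_eq_zero`. -/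
def genLE (h : ℕ) (z : ℂ) : ℂ :=
  ∑ n ∈ Finset.range (2 ^ h + 1), (treeCountLE h n : ℂ) * z ^ n

/-- `ρ`: the radius of convergence of `∑ y_n z ^ n`. -/
def rho : ℝ :=
  (FormalMultilinearSeries.ofScalars ℂ (fun n => (treeCount n : ℂ))).radius.toReal

/-- The `Δ`-domain `{z : |z| < ρ + ε, z ≠ ρ, |arg (z - ρ)| > φ}`. -/
def deltaDomain (ε φ : ℝ) : Set ℂ :=
  {z | ‖z‖ < rho + ε ∧ z ≠ (rho : ℂ) ∧ φ < |Complex.arg (z - rho)|}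

/-- `y` is the function `y(z)`: the analytic continuation to the given `Δ`-domain of the generating
function `∑ y_n z ^ n` of all trees. (For `0 < ε` and `0 < φ < π / 2` the `Δ`-domain is open, star-shaped
about `0` and contains the disc `|z| < ρ`.) -/
def IsTreeGF (y : ℂ → ℂ) (ε φ : ℝ) : Prop :=
  AnalyticOnNhd ℂ y (deltaDomain ε φ) ∧
    ∀ z : ℂ, ‖z‖ < rho → HasSum (fun n : ℕ => (treeCount n : ℂ) * z ^ n) (y z)

/-- The sandclock of radius `r₀` and angle `θ₀` anchored at `ρ`. -/
def sandclock (r₀ θ₀ : ℝ) : Set ℂ :=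
  {z | ‖z - rho‖ < r₀ ∧ Real.pi / 2 - θ₀ < |Complex.arg (z - rho)| ∧
    |Complex.arg (z - rho)| < Real.pi / 2 + θ₀}

/-- `e_h(z) = y(z) - y_h(z)`: the generating function of trees of height exceeding `h`. -/
def genGT (y : ℂ → ℂ) (h : ℕ) (z : ℂ) : ℂ := y z - genLE h z

/-- The remainder `R_h(z)`, defined by `y ^ h / e_h = (1 / 2) (1 - y ^ h) / (1 - y) + R_h(z)`. -/
def remainder (y : ℂ → ℂ) (h : ℕ) (z : ℂ) : ℂ :=
  y z ^ h / genGT y h z - 1 / 2 * ((1 - y z ^ h) / (1 - y z))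

end NonPlaneTree

end

/-! ### Decomposition of trees at the root and the recursion for bounded height. -/

namespace NonPlaneTree

open Finset

/-! Splitting at the root gives `y = z + y^2/2 + y(z^2)/2`, that is `(1 - y)^2 = 1 - 2z - y(z^2)`,
the function `discr`. Since `rho < 1`, `discr` is analytic beyond the disc. It has a simple zero at
`rho` (`discr_rho`, `exists_hasDerivAt_discr`) and positive real part elsewhere on the closed disc,
so its principal square root continues `y`, with `y(rho) = 1`.

Subtracting the recursion for bounded height gives `e_{h+1} = y e_h - e_h^2/2 + d_h`, where `d_h =
e_h(z^2)/2` is exponentially small (`genGT_succ`). For `f_h = y^h/e_h` this reads `f_{h+1} = f_h +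
y^h/2 + error`. The main terms sum to half of `geomSum y h`, and `R_h` collects the errors. With `r
= |y|` and `L_h = 1 + r + ... + r^(h-1)`, each error is `O(r^h/L_h)` as long as `f_h` has order
`L_h` (`norm_div_sub_div_le`). These errors add up to `O(log L_h)`, and `L_h` is at most both `1/(1
- r)` and `h`. Each single error is `O(1/h)` because `h r^h ≤ L_h`.

That `f_h` has order `L_h` is propagated by induction (`iterate_bounds`), with two inputs. In a thin
sandclock `1 - y` behaves like the square root of a nearly imaginary number, so `|1 - y| ≤ 4(1 -
|y|)` and `|geomSum y h|` is comparable to `L_h` (`norm_treeGF_lt_one`, `geomSum_norm_le`). At `rho`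
itself `1/e_h ~ h/2`, so the induction can start at some large fixed `h₀` there, and by continuity
at every nearby point (`exists_start`, `exists_remainder_bounds`). -/

/-- The tree consisting of one external node. -/
def leaf : NPTree := Quotient.mk swapSetoid .nil

/-- The tree whose root carries the given unordered pair of trees. -/
def join (p : Sym2 NPTree) : NPTree :=
  Sym2.lift ⟨fun s t => Quotient.map₂ (sc := swapSetoid) (BinaryTree.node ())
    (fun _ _ h₁ _ _ h₂ => SwapEquiv.node h₁ h₂) s t, fun s t => by
      induction s using Quotient.inductionOn
      induction t using Quotient.inductionOn
      exact Quotient.sound (SwapEquiv.swap (SwapEquiv.refl _) (SwapEquiv.refl _))⟩ p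

@[simp] theorem size_leaf : leaf.size = 1 := rfl

@[simp] theorem height_leaf : leaf.height = 0 := rfl

@[simp] theorem size_join (s t : NPTree) : (join s(s, t)).size = s.size + t.size := by
  induction s using Quotient.inductionOn
  induction t using Quotient.inductionOn
  rfl

@[simp] theorem height_join (s t : NPTree) :
    (join s(s, t)).height = max s.height t.height + 1 := by
  induction s using Quotient.inductionOn
  induction t using Quotient.inductionOn
  rfl

theorem join_injective : Function.Injective join := by
  intro p q
  induction p using Sym2.inductionOn with | _ a b
  induction q using Sym2.inductionOn with | _ c d
  induction a using Quotient.inductionOn with | _ a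
  induction b using Quotient.inductionOn with | _ b
  induction c using Quotient.inductionOn with | _ c
  induction d using Quotient.inductionOn with | _ d
  intro h
  have h' : SwapEquiv (.node () a b) (.node () c d) := Quotient.exact h
  refine Sym2.eq_iff.2 ?_
  cases h' with
  | node h₁ h₂ => exact Or.inl ⟨Quotient.sound h₁, Quotient.sound h₂⟩
  | swap h₁ h₂ => exact Or.inr ⟨Quotient.sound h₁, Quotient.sound h₂⟩

theorem eq_leaf_or_join (t : NPTree) : t = leaf ∨ ∃ p, t = join p := by
  induction t using Quotient.inductionOn with | _ t
  cases t with
  | nil => exact Or.inl rfl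
  | node u a b =>
    exact Or.inr ⟨s(Quotient.mk swapSetoid a, Quotient.mk swapSetoid b), rfl⟩

theorem height_join_pos (p : Sym2 NPTree) : 0 < (join p).height := by
  induction p using Sym2.inductionOn
  simp

theorem height_lt_size (t : NPTree) : t.height < t.size := by
  induction t using Quotient.inductionOn with | _ t
  have h := t.height_le_numNodes
  have h' := t.numLeaves_eq_numNodes_succ
  change t.height < t.numLeaves
  omega

open Classical in
/-- The finite set of trees of height at most `h`. -/
noncomputable def treesLE : ℕ → Finset NPTree
  | 0 => {leaf}
  | h + 1 => insert leaf ((treesLE h).sym2.image join)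

theorem mem_treesLE {h : ℕ} {t : NPTree} : t ∈ treesLE h ↔ t.height ≤ h := by
  induction h generalizing t with
  | zero =>
    rw [treesLE, mem_singleton]
    rcases eq_leaf_or_join t with rfl | ⟨p, rfl⟩
    · simp
    · have := height_join_pos p
      constructor
      · intro h
        rw [h, height_leaf] at this
        omega
      · omega
  | succ h ih =>
    simp only [treesLE, mem_insert, mem_image]
    rcases eq_leaf_or_join t with rfl | ⟨p, rfl⟩
    · simp
    · have hp := height_join_pos p
      have hne : join p ≠ leaf := fun h => by rw [h, height_leaf] at hp; omega
      simp only [hne, false_or, join_injective.eq_iff, exists_eq_right]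
      induction p using Sym2.inductionOn with | _ a b
      simp [ih]

theorem treeCountLE_eq_card (h n : ℕ) [DecidablePred fun t : NPTree => t.size = n] :
    treeCountLE h n = #{t ∈ treesLE h | t.size = n} := by
  rw [treeCountLE, ← Fintype.card_coe, ← Nat.card_eq_fintype_card]
  exact Nat.card_congr (Equiv.subtypeEquivRight fun t => by
    rw [mem_filter, mem_treesLE, and_comm])

theorem treeCountLE_eq_treeCount {h n : ℕ} (hn : n ≤ h + 1) : treeCountLE h n = treeCount n := by
  refine Nat.card_congr (Equiv.subtypeEquivRight fun t => ?_)
  have := height_lt_size t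
  constructor
  · exact fun h => h.1
  · exact fun h => ⟨h, by omega⟩

theorem treeCountLE_mono {h k : ℕ} (hk : h ≤ k) (n : ℕ) : treeCountLE h n ≤ treeCountLE k n := by
  classical
  rw [treeCountLE_eq_card, treeCountLE_eq_card]
  exact card_le_card fun t => by
    simp only [mem_filter, mem_treesLE]
    exact fun h => ⟨h.1.trans hk, h.2⟩

theorem treeCountLE_le_treeCount (h n : ℕ) : treeCountLE h n ≤ treeCount n :=
  (treeCountLE_mono (le_max_left h n) n).trans_eq
    (treeCountLE_eq_treeCount (by have := le_max_right h n; omega))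

theorem treeCount_zero : treeCount 0 = 0 := by
  have : IsEmpty {t : NPTree // t.size = 0} :=
    ⟨fun ⟨t, ht⟩ => by have := height_lt_size t; omega⟩
  exact Nat.card_of_isEmpty

theorem treeCount_one : treeCount 1 = 1 := by
  classical
  rw [← treeCountLE_eq_treeCount (h := 0) (by simp), treeCountLE_eq_card, treesLE,
    filter_singleton, size_leaf]
  simp

/-- The square counts an unordered pair of distinct elements twice and a diagonal pair once; the sum
of squares supplies the missing diagonal term. -/
theorem two_mul_sum_sym2 {α K : Type*} [CommRing K] (s : Finset α) (g : α → K) :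
    2 * ∑ p ∈ s.sym2, Sym2.lift ⟨fun a b => g a * g b, fun _ _ => mul_comm _ _⟩ p =
      (∑ a ∈ s, g a) ^ 2 + ∑ a ∈ s, g a ^ 2 := by
  classical
  induction s using Finset.induction_on with
  | empty => simp
  | insert a s ha ih =>
    rw [sym2_insert, sum_union, mul_add, ih, sum_image, sum_insert ha, sum_insert ha, sum_insert ha]
    · simp only [Sym2.lift_mk, ← mul_sum]
      ring
    · intro b _ c _ h
      exact Sym2.congr_right.1 h
    · rw [disjoint_left]
      intro p hp hp'
      obtain ⟨b, -, rfl⟩ := mem_image.1 hp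
      exact ha (mk_mem_sym2_iff.1 hp').1

/-- The generating polynomial of trees of height at most `h`, over any field. -/
noncomputable def treePoly {K : Type*} [Field K] (h : ℕ) (z : K) : K :=
  ∑ n ∈ range (2 ^ h + 1), (treeCountLE h n : K) * z ^ n

theorem genLE_eq_treePoly (h : ℕ) (z : ℂ) : genLE h z = treePoly h z := rfl

section Field

variable {K : Type*} [Field K]

theorem treePoly_eq_sum (h : ℕ) (z : K) : treePoly h z = ∑ t ∈ treesLE h, z ^ t.size := by
  classical
  have hmaps : ∀ t ∈ treesLE h, t.size ∈ range (2 ^ h + 1) := by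
    intro t ht
    rw [mem_treesLE] at ht
    by_contra hn
    rw [mem_range, not_lt] at hn
    have h0 := treeCountLE_eq_zero (h := h) (n := t.size) (by omega)
    rw [treeCountLE_eq_card, card_eq_zero] at h0
    exact notMem_empty t (h0 ▸ mem_filter.2 ⟨mem_treesLE.2 ht, rfl⟩)
  rw [treePoly, ← sum_fiberwise_of_maps_to hmaps]
  refine sum_congr rfl fun n _ => ?_
  rw [treeCountLE_eq_card, sum_congr rfl (g := fun _ => z ^ n)
    (fun t ht => by rw [(mem_filter.1 ht).2]), sum_const, nsmul_eq_mul]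

theorem treePoly_zero (z : K) : treePoly 0 z = z := by
  rw [treePoly_eq_sum, treesLE, sum_singleton, size_leaf, pow_one]

theorem treePoly_succ [CharZero K] (h : ℕ) (z : K) :
    treePoly (h + 1) z = z + treePoly h z ^ 2 / 2 + treePoly h (z ^ 2) / 2 := by
  classical
  have hkey := two_mul_sum_sym2 (treesLE h) (fun t => z ^ t.size)
  have hleaf : leaf ∉ (treesLE h).sym2.image join := by
    intro hm
    obtain ⟨p, -, hp⟩ := mem_image.1 hm
    have := height_join_pos p
    rw [hp, height_leaf] at this
    omega
  have hsum : ∑ p ∈ (treesLE h).sym2, z ^ (join p).size = ∑ p ∈ (treesLE h).sym2,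
      Sym2.lift ⟨fun a b : NPTree => z ^ a.size * z ^ b.size, fun _ _ => mul_comm _ _⟩ p := by
    refine sum_congr rfl fun p _ => ?_
    induction p using Sym2.inductionOn
    simp [pow_add]
  rw [treePoly_eq_sum, treePoly_eq_sum, treePoly_eq_sum, treesLE, sum_insert hleaf,
    sum_image (join_injective.injOn), hsum, size_leaf, pow_one]
  have hpow : ∑ t ∈ treesLE h, (z ^ 2) ^ t.size = ∑ t ∈ treesLE h, (z ^ t.size) ^ 2 :=
    sum_congr rfl fun t _ => by rw [← pow_mul, ← pow_mul, mul_comm]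
  rw [hpow, add_assoc, ← add_div, ← hkey]
  field_simp

/-- The polynomial `treePoly h` as an infinite series. -/
theorem hasSum_treePoly [TopologicalSpace K] (h : ℕ) (z : K) :
    HasSum (fun n => (treeCountLE h n : K) * z ^ n) (treePoly h z) :=
  hasSum_sum_of_ne_finset_zero fun n hn => by
    rw [mem_range, not_lt] at hn
    rw [treeCountLE_eq_zero (by omega), Nat.cast_zero, zero_mul]

end Field

end NonPlaneTree

/-! ### The full generating function and its functional equation. -/

namespace NonPlaneTree

open Filter Topology

section Series

variable {K : Type*} [RCLike K]

/-- The generating function of all trees, as the sum of a power series. -/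
noncomputable def treeSeries (z : K) : K := ∑' n : ℕ, (treeCount n : K) * z ^ n

theorem summable_mono {x x' : ℝ} (hx : 0 ≤ x) (hxx' : x ≤ x')
    (hs : Summable fun n => (treeCount n : ℝ) * x' ^ n) :
    Summable fun n => (treeCount n : ℝ) * x ^ n :=
  hs.of_nonneg_of_le (fun n => by positivity) fun n => by gcongr

theorem summable_treeCount {z : K} (hs : Summable fun n => (treeCount n : ℝ) * ‖z‖ ^ n) :
    Summable fun n => (treeCount n : K) * z ^ n :=
  Summable.of_norm (by simpa using hs)

theorem norm_treeSeries_le {z : K} (hs : Summable fun n => (treeCount n : ℝ) * ‖z‖ ^ n) :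
    ‖treeSeries z‖ ≤ treeSeries ‖z‖ := by
  refine (norm_tsum_le_tsum_norm (by simpa using hs)).trans_eq ?_
  simp [treeSeries]

theorem treeSeries_ofReal (x : ℝ) : treeSeries (x : ℂ) = (treeSeries x : ℝ) := by
  simp [treeSeries, Complex.ofReal_tsum]

theorem treePoly_ofReal (h : ℕ) (x : ℝ) : treePoly h (x : ℂ) = (treePoly h x : ℝ) := by
  simp [treePoly]

theorem tendsto_treePoly {z : K} (hs : Summable fun n => (treeCount n : ℝ) * ‖z‖ ^ n) :
    Tendsto (fun h => treePoly h z) atTop (𝓝 (treeSeries z)) := by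
  have : (fun h => treePoly h z) = fun h => ∑' n, (treeCountLE h n : K) * z ^ n :=
    funext fun h => (hasSum_treePoly h z).tsum_eq.symm
  rw [this]
  refine tendsto_tsum_of_dominated_convergence hs (fun n => ?_) (Eventually.of_forall fun h n => ?_)
  · refine tendsto_const_nhds.congr' ?_
    filter_upwards [eventually_ge_atTop n] with h hn
    rw [treeCountLE_eq_treeCount (by omega)]
  · rw [norm_mul, norm_pow, RCLike.norm_natCast]
    gcongr
    exact treeCountLE_le_treeCount h n

theorem treeSeries_eq {z : K} (hz : ‖z‖ ≤ 1)
    (hs : Summable fun n => (treeCount n : ℝ) * ‖z‖ ^ n) :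
    treeSeries z = z + treeSeries z ^ 2 / 2 + treeSeries (z ^ 2) / 2 := by
  have hs' : Summable fun n => (treeCount n : ℝ) * ‖z ^ 2‖ ^ n :=
    summable_mono (norm_nonneg _) (by rw [norm_pow]; nlinarith [norm_nonneg z]) hs
  refine tendsto_nhds_unique ((tendsto_add_atTop_iff_nat 1).2 (tendsto_treePoly hs)) ?_
  simp only [treePoly_succ]
  exact (((tendsto_treePoly hs).pow 2).div_const 2).const_add z |>.add
    ((tendsto_treePoly hs').div_const 2)

/-- Only degrees above `h` contribute, since a tree has height less than its size; there `q ^ n ≤ q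
^ h`. Applied at squared arguments, this makes the perturbation `d_h` geometrically small. -/
theorem norm_treeSeries_sub_treePoly_le {z : K} {q s : ℝ} (hq : 0 ≤ q) (hq1 : q ≤ 1) (hs0 : 0 ≤ s)
    (hz : ‖z‖ ≤ q * s) (hs : Summable fun n => (treeCount n : ℝ) * s ^ n) (h : ℕ) :
    ‖treeSeries z - treePoly h z‖ ≤ q ^ h * treeSeries s := by
  have hz' : ‖z‖ ≤ s := hz.trans (mul_le_of_le_one_left hs0 hq1)
  have hsz := (summable_treeCount (summable_mono (norm_nonneg z) hz' hs)).hasSum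
  have hd := hsz.sub (hasSum_treePoly h z)
  refine hd.norm_le_of_bounded (hs.hasSum.mul_left (q ^ h)) fun n => ?_
  rcases le_or_gt n h with hn | hn
  · rw [treeCountLE_eq_treeCount (by omega), sub_self, norm_zero]
    positivity
  · rw [← sub_mul, norm_mul, norm_pow]
    have h1 : ‖(treeCount n : K) - (treeCountLE h n : K)‖ ≤ treeCount n := by
      rw [← Nat.cast_sub (treeCountLE_le_treeCount h n), RCLike.norm_natCast]
      exact_mod_cast Nat.sub_le _ _
    have h2 : ‖z‖ ^ n ≤ q ^ h * s ^ n :=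
      calc ‖z‖ ^ n ≤ (q * s) ^ n := by gcongr
        _ = q ^ n * s ^ n := mul_pow _ _ _
        _ ≤ q ^ h * s ^ n :=
          mul_le_mul_of_nonneg_right (pow_le_pow_of_le_one hq hq1 hn.le) (pow_nonneg hs0 n)
    calc _ ≤ (treeCount n : ℝ) * (q ^ h * s ^ n) := by gcongr
      _ = _ := by ring

end Series

/-! ### The radius of convergence: `discr` vanishes at `rho` and the series equals one there. -/

section Real

theorem treePoly_nonneg {x : ℝ} (hx : 0 ≤ x) (h : ℕ) : 0 ≤ treePoly h x :=
  Finset.sum_nonneg fun n _ => by positivity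

theorem treePoly_le_treeSeries {x : ℝ} (hx : 0 ≤ x)
    (hs : Summable fun n => (treeCount n : ℝ) * x ^ n) (h : ℕ) : treePoly h x ≤ treeSeries x :=
  hasSum_le (fun n => by
    gcongr
    exact treeCountLE_le_treeCount h n) (hasSum_treePoly h x) hs.hasSum

theorem summable_of_treePoly_le {x B : ℝ} (hx : 0 ≤ x) (hB : ∀ h, treePoly h x ≤ B) :
    Summable fun n => (treeCount n : ℝ) * x ^ n := by
  refine summable_of_sum_range_le (c := B) (fun n => by positivity) fun N => ?_
  refine le_trans (le_of_eq ?_) ((sum_le_hasSum (Finset.range N) (fun n _ => by positivity)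
    (hasSum_treePoly N x)).trans (hB N))
  refine Finset.sum_congr rfl fun n hn => ?_
  rw [treeCountLE_eq_treeCount (by rw [Finset.mem_range] at hn; omega)]

/-- The discriminant `1 - 2 z - y(z ^ 2)` of the quadratic equation satisfied by `y(z)`. -/
noncomputable def discr {K : Type*} [RCLike K] (z : K) : K := 1 - 2 * z - treeSeries (z ^ 2)

theorem one_sub_treeSeries_sq {K : Type*} [RCLike K] {z : K} (hz : ‖z‖ ≤ 1)
    (hs : Summable fun n => (treeCount n : ℝ) * ‖z‖ ^ n) : (1 - treeSeries z) ^ 2 = discr z := by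
  have h := treeSeries_eq hz hs
  rw [discr]
  linear_combination -2 * h

theorem treeSeries_nonneg {x : ℝ} (hx : 0 ≤ x) : 0 ≤ treeSeries x :=
  tsum_nonneg fun n => by positivity

/-- The bound is a fixed point of the monotone map `u ↦ x + u^2/2 + y(x^2)/2`, which dominates the
recursion in the height. So a nonnegative discriminant forces convergence at `x`. -/
theorem treePoly_le_one_sub_sqrt {x : ℝ} (hx : 0 ≤ x)
    (hs : Summable fun n => (treeCount n : ℝ) * (x ^ 2) ^ n) (hd : 0 ≤ discr x) (h : ℕ) :
    treePoly h x ≤ 1 - √(discr x) := by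
  have h2 : 0 ≤ treeSeries (x ^ 2) := treeSeries_nonneg (by positivity)
  induction h with
  | zero =>
    rw [treePoly_zero, le_sub_comm]
    refine Real.sqrt_le_iff.2 ?_
    rw [discr] at hd ⊢
    constructor <;> nlinarith
  | succ h ih =>
    have h3 := treePoly_le_treeSeries (by positivity) hs h
    have h4 := treePoly_nonneg hx h
    have h5 := Real.sq_sqrt hd
    rw [treePoly_succ]
    have h6 : treePoly h x ^ 2 ≤ (1 - √(discr x)) ^ 2 := by gcongr
    have h7 : (1 - √(discr x)) ^ 2 = 1 - 2 * √(discr x) + discr x := by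
      rw [← h5, Real.sqrt_sq (Real.sqrt_nonneg _)]; ring
    rw [h7] at h6
    have h8 : discr x = 1 - 2 * x - treeSeries (x ^ 2) := rfl
    linarith

theorem summable_of_discr_nonneg {x : ℝ} (hx : 0 ≤ x)
    (hs : Summable fun n => (treeCount n : ℝ) * (x ^ 2) ^ n) (hd : 0 ≤ discr x) :
    Summable fun n => (treeCount n : ℝ) * x ^ n :=
  summable_of_treePoly_le hx (treePoly_le_one_sub_sqrt hx hs hd)

theorem treePoly_sq_le {x : ℝ} (hx : 0 ≤ x) (hx1 : x ≤ 1) (h : ℕ) :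
    treePoly h (x ^ 2) ≤ x * treePoly h x := by
  rw [treePoly, treePoly, Finset.mul_sum]
  refine Finset.sum_le_sum fun n _ => ?_
  rcases Nat.eq_zero_or_pos n with rfl | hn
  · have : treeCountLE h 0 = 0 := by
      have := treeCountLE_le_treeCount h 0
      rw [treeCount_zero] at this
      omega
    simp [this]
  · rw [mul_left_comm]
    gcongr
    rw [← pow_mul, mul_comm x, ← pow_succ]
    exact pow_le_pow_of_le_one hx hx1 (by omega)

theorem summable_quarter : Summable fun n => (treeCount n : ℝ) * (1 / 4 : ℝ) ^ n := by
  refine summable_of_treePoly_le (B := 1 / 2) (by norm_num) fun h => ?_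
  induction h with
  | zero => rw [treePoly_zero]; norm_num
  | succ h ih =>
    have h1 := treePoly_sq_le (x := 1 / 4) (by norm_num) (by norm_num) h
    have h2 := treePoly_nonneg (x := 1 / 4) (by norm_num) h
    rw [treePoly_succ]
    nlinarith

theorem le_half_of_summable {x : ℝ} (hx : 0 ≤ x) (hx1 : x ≤ 1)
    (hs : Summable fun n => (treeCount n : ℝ) * x ^ n) : x ≤ 1 / 2 := by
  have hn : ‖x‖ = x := Real.norm_of_nonneg hx
  have h := one_sub_treeSeries_sq (z := x) (by rwa [hn]) (by rwa [hn])
  have h1 := treeSeries_nonneg (x := x ^ 2) (by positivity)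
  rw [discr] at h
  nlinarith [sq_nonneg (1 - treeSeries x)]

/-- The power series of `treeSeries`, whose radius of convergence defines `rho`. -/
noncomputable def treeFPS : FormalMultilinearSeries ℂ ℂ ℂ :=
  FormalMultilinearSeries.ofScalars ℂ (fun n => (treeCount n : ℂ))

theorem norm_treeFPS (n : ℕ) : ‖treeFPS n‖ = treeCount n := by
  rw [treeFPS, FormalMultilinearSeries.ofScalars_norm]
  simp

theorem radius_treeFPS_le : treeFPS.radius ≤ ((1 / 2 : NNReal) : ENNReal) := by
  refine ENNReal.le_of_forall_nnreal_lt fun r hr => ?_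
  have hs := treeFPS.summable_norm_mul_pow hr
  simp only [norm_treeFPS] at hs
  -- The functional equation is available only up to modulus one, hence the cap, removed afterwards
  -- because `1` exceeds `1/2`.
  have h1 : ((min r 1 : NNReal) : ℝ) ≤ 1 / 2 :=
    le_half_of_summable (NNReal.coe_nonneg _) (by simp)
      (summable_mono (NNReal.coe_nonneg _) (by simp) hs)
  have h2 : (min r 1 : NNReal) ≤ 1 / 2 := by exact_mod_cast h1
  have h3 : r ≤ 1 / 2 := (min_le_iff.1 h2).resolve_right (not_le.2 (by
    rw [← NNReal.coe_lt_coe]; norm_num))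
  exact_mod_cast h3

theorem radius_treeFPS : treeFPS.radius = ENNReal.ofReal rho :=
  (ENNReal.ofReal_toReal (radius_treeFPS_le.trans_lt ENNReal.coe_lt_top).ne).symm

theorem rho_le_half : rho ≤ 1 / 2 := by
  have h := ENNReal.toReal_mono ENNReal.coe_ne_top radius_treeFPS_le
  simpa [rho, treeFPS] using h

theorem le_rho_of_summable {x : ℝ} (hx : 0 ≤ x)
    (hs : Summable fun n => (treeCount n : ℝ) * x ^ n) : x ≤ rho := by
  lift x to NNReal using hx
  have h := treeFPS.le_radius_of_summable (r := x) (by simpa only [norm_treeFPS] using hs)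
  have h' := ENNReal.toReal_mono (radius_treeFPS_le.trans_lt ENNReal.coe_lt_top).ne h
  exact h'

theorem quarter_le_rho : 1 / 4 ≤ rho := le_rho_of_summable (by norm_num) summable_quarter

theorem rho_pos : 0 < rho := by linarith [quarter_le_rho]

theorem summable_of_lt_rho {x : ℝ} (hx : 0 ≤ x) (hx' : x < rho) :
    Summable fun n => (treeCount n : ℝ) * x ^ n := by
  lift x to NNReal using hx
  have h : (x : ENNReal) < treeFPS.radius := by
    rw [radius_treeFPS, ← ENNReal.ofReal_coe_nnreal]
    exact (ENNReal.ofReal_lt_ofReal_iff rho_pos).2 hx'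
  simpa only [norm_treeFPS] using treeFPS.summable_norm_mul_pow h

theorem analyticAt_treeSeries {z : ℂ} (hz : ‖z‖ < rho) : AnalyticAt ℂ treeSeries z := by
  have hpos : 0 < treeFPS.radius := by
    rw [radius_treeFPS]
    exact ENNReal.ofReal_pos.2 rho_pos
  have h := treeFPS.hasFPowerSeriesOnBall hpos
  have he : treeFPS.sum = treeSeries := by
    funext w
    simp [treeFPS, treeSeries, FormalMultilinearSeries.sum, mul_comm]
  rw [← he]
  refine h.analyticAt_of_mem ?_
  rw [radius_treeFPS, Metric.mem_eball, edist_zero_right, ← ofReal_norm]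
  exact (ENNReal.ofReal_lt_ofReal_iff rho_pos).2 hz

theorem sq_lt_rho {x : ℝ} (hx : 0 ≤ x) (hx' : x ≤ rho + 1 / 8) : x ^ 2 < rho := by
  nlinarith [rho_le_half, quarter_le_rho]

theorem analyticAt_discr {z : ℂ} (hz : ‖z‖ ≤ rho + 1 / 8) : AnalyticAt ℂ discr z := by
  have h1 : AnalyticAt ℂ (treeSeries : ℂ → ℂ) ((fun z : ℂ => z ^ 2) z) :=
    analyticAt_treeSeries (by
      rw [norm_pow]
      exact sq_lt_rho (norm_nonneg z) hz)
  have h2 : AnalyticAt ℂ (fun z : ℂ => z ^ 2) z := analyticAt_id.pow 2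
  exact (analyticAt_const.sub (analyticAt_const.mul analyticAt_id)).sub
    (AnalyticAt.fun_comp (g := treeSeries) (f := fun z : ℂ => z ^ 2) h1 h2)

theorem discr_ofReal (x : ℝ) : discr (x : ℂ) = (discr x : ℝ) := by
  simp only [discr]
  rw [← Complex.ofReal_pow, treeSeries_ofReal]
  push_cast
  rfl

theorem continuousAt_discr_rho : ContinuousAt (discr : ℝ → ℝ) rho := by
  have h1 : ContinuousAt (discr : ℂ → ℂ) (rho : ℂ) :=
    (analyticAt_discr (by simp [abs_of_pos rho_pos])).continuousAt
  have h2 : ContinuousAt (fun x : ℝ => (discr (x : ℂ)).re) rho :=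
    Complex.continuous_re.continuousAt.comp
      (ContinuousAt.comp (f := fun x : ℝ => (x : ℂ)) h1 Complex.continuous_ofReal.continuousAt)
  simpa [discr_ofReal] using h2

/-- A positive value would persist slightly to the right of `rho` and force convergence there. To
the left of `rho` the discriminant is a real square, so its limit is nonnegative. -/
theorem discr_rho : discr rho = 0 := by
  refine le_antisymm ?_ ?_
  · by_contra! hpos
    have h1 : ∀ᶠ x in 𝓝[>] rho, 0 < discr x :=
      (continuousAt_discr_rho.eventually (lt_mem_nhds hpos)).filter_mono nhdsWithin_le_nhds
    have h2 : ∀ᶠ x in 𝓝[>] rho, x ≤ rho + 1 / 8 :=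
      (eventually_le_nhds (by linarith)).filter_mono nhdsWithin_le_nhds
    obtain ⟨x, ⟨hx1, hx2⟩, hx3⟩ := ((h1.and h2).and self_mem_nhdsWithin).exists
    have hx3 : rho < x := hx3
    have hx0 : 0 ≤ x := rho_pos.le.trans hx3.le
    have h3 := summable_of_lt_rho (by positivity) (sq_lt_rho hx0 hx2)
    exact absurd (le_rho_of_summable hx0 (summable_of_discr_nonneg hx0 h3 hx1.le)) (not_le.2 hx3)
  · refine ge_of_tendsto (continuousAt_discr_rho.mono_left (nhdsWithin_le_nhds (s := Set.Iio rho))) ?_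
    filter_upwards [self_mem_nhdsWithin, mem_nhdsWithin_of_mem_nhds (lt_mem_nhds rho_pos)]
      with x hx hx0
    have hx : x < rho := hx
    have hx0 : 0 < x := hx0
    have hn : ‖x‖ = x := Real.norm_of_nonneg hx0.le
    rw [← one_sub_treeSeries_sq (by rw [hn]; linarith [rho_le_half])
      (by rw [hn]; exact summable_of_lt_rho hx0.le hx)]
    positivity

theorem summable_rho : Summable fun n => (treeCount n : ℝ) * rho ^ n :=
  summable_of_discr_nonneg rho_pos.le (summable_of_lt_rho (by positivity)
    (sq_lt_rho rho_pos.le (by linarith))) discr_rho.ge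

theorem summable_of_le_rho {x : ℝ} (hx : 0 ≤ x) (hx' : x ≤ rho) :
    Summable fun n => (treeCount n : ℝ) * x ^ n :=
  summable_mono hx hx' summable_rho

theorem treeSeries_rho : treeSeries rho = 1 := by
  have hn : ‖rho‖ = rho := Real.norm_of_nonneg rho_pos.le
  have h := one_sub_treeSeries_sq (z := rho) (by rw [hn]; linarith [rho_le_half])
    (by rw [hn]; exact summable_rho)
  rw [discr_rho] at h
  nlinarith [pow_eq_zero_iff (two_ne_zero) |>.1 h]

theorem treeSeries_lt_one {x : ℝ} (hx : 0 ≤ x) (hx' : x < rho) : treeSeries x < 1 := by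
  rw [← treeSeries_rho]
  refine Summable.tsum_lt_tsum (i := 1) (fun n => ?_) ?_ (summable_of_lt_rho hx hx') summable_rho
  · dsimp only
    gcongr
  · simpa [treeCount_one] using hx'

end Real

/-! ### Decay of the error at `rho`. -/

/-- A positive sequence with `e (h + 1) = e h - e h ^ 2 / 2 + d h`, where `d` is exponentially small,
satisfies `1 / e h ∼ h / 2`. -/
theorem tendsto_inv_div_of_recurrence {e d : ℕ → ℝ} (he : ∀ h, 0 < e h) (he1 : ∀ h, e h ≤ 1)
    (hrec : ∀ h, e (h + 1) = e h - e h ^ 2 / 2 + d h) (hd : ∀ h, 0 ≤ d h) {q : ℝ} (hq0 : 0 ≤ q)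
    (hq : q < 1) (hdq : ∀ h, d h ≤ q ^ h) (hlim : Tendsto e atTop (𝓝 0)) :
    Tendsto (fun h : ℕ => (h : ℝ)⁻¹ * (e h)⁻¹) atTop (𝓝 (1 / 2)) := by
  set v : ℕ → ℝ := fun h => (e h)⁻¹ with hv
  have hstep : ∀ h, v (h + 1) ≤ v h + 1 := by
    intro h
    have h1 := he h
    have h2 := he1 h
    have h3 := he (h + 1)
    have h4 : e h * (1 - e h / 2) ≤ e (h + 1) := by nlinarith [hrec h, hd h]
    rw [hv]
    dsimp only
    rw [inv_le_iff_one_le_mul₀ h3]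
    have : ((e h)⁻¹ + 1) * (e h * (1 - e h / 2)) = 1 + e h * (1 - e h) / 2 := by
      field_simp
      ring
    calc (1 : ℝ) ≤ ((e h)⁻¹ + 1) * (e h * (1 - e h / 2)) := by
          rw [this]
          nlinarith
      _ ≤ _ := by gcongr
  -- Linear growth of the inverse is enough for `d h * v h ^ 2` to vanish; then the increments of
  -- `v` tend to `1/2`, and Cesàro averaging concludes.
  have hvle : ∀ h : ℕ, v h ≤ h + v 0 := by
    intro h
    induction h with
    | zero => simp
    | succ h ih => push_cast; linarith [hstep h]
  have hv0 : ∀ h, 0 < v h := fun h => inv_pos.2 (he h)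
  have hdv : Tendsto (fun h => d h * v h ^ 2) atTop (𝓝 0) := by
    have hlim2 : Tendsto (fun h : ℕ => (1 + v 0) ^ 2 * ((h : ℝ) ^ 2 * q ^ h)) atTop (𝓝 0) := by
      simpa using (tendsto_pow_const_mul_const_pow_of_lt_one 2 hq0 hq).const_mul ((1 + v 0) ^ 2)
    refine squeeze_zero' (Eventually.of_forall fun h => mul_nonneg (hd h) (sq_nonneg _)) ?_ hlim2
    filter_upwards [eventually_ge_atTop 1] with h hh
    have hh' : (1 : ℝ) ≤ h := by exact_mod_cast hh
    have h1 : v h ≤ (1 + v 0) * h := by nlinarith [hvle h, hv0 0]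
    calc d h * v h ^ 2 ≤ q ^ h * ((1 + v 0) * h) ^ 2 := by
          gcongr
          · exact hdq h
          · exact (hv0 h).le
      _ = _ := by ring
  have hratio : Tendsto (fun h => 1 - e h / 2 + d h * v h ^ 2 * e h) atTop (𝓝 1) := by
    simpa using (tendsto_const_nhds.sub (hlim.div_const 2)).add (hdv.mul hlim)
  have hdiff : Tendsto (fun h => v (h + 1) - v h) atTop (𝓝 (1 / 2)) := by
    have h1 : Tendsto (fun h => (1 / 2 - d h * v h ^ 2) / (1 - e h / 2 + d h * v h ^ 2 * e h))
        atTop (𝓝 (1 / 2)) := by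
      simpa [Pi.div_def] using
        ((tendsto_const_nhds (x := (1 / 2 : ℝ))).sub hdv).div hratio one_ne_zero
    refine h1.congr fun h => ?_
    have h2 : e (h + 1) = e h * (1 - e h / 2 + d h * v h ^ 2 * e h) := by
      rw [hrec h, hv]
      have := (he h).ne'
      field_simp
    have h3 := he (h + 1)
    have h4 : 1 - e h / 2 + d h * v h ^ 2 * e h ≠ 0 := fun h0 => by
      rw [h2, h0, mul_zero] at h3
      exact lt_irrefl _ h3
    have h5 := (he h).ne'
    have h6 : v (h + 1) = v h / (1 - e h / 2 + d h * v h ^ 2 * e h) := by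
      change (e (h + 1))⁻¹ = _
      rw [h2, mul_inv]
      exact (div_eq_mul_inv _ _).symm
    rw [h6, div_eq_iff h4, sub_mul, div_mul_cancel₀ _ h4]
    have h7 : v h * e h = 1 := inv_mul_cancel₀ h5
    linear_combination (-(1 / 2 : ℝ) + d h * v h ^ 2) * h7
  have hces := hdiff.cesaro
  simp only [Finset.sum_range_sub] at hces
  have hn : Tendsto (fun h : ℕ => (h : ℝ)⁻¹ * v 0) atTop (𝓝 0) := by
    simpa using tendsto_inv_atTop_nhds_zero_nat.mul_const (v 0)
  simpa [mul_sub] using hces.add hn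

theorem tendsto_inv_one_sub_treePoly_rho :
    (∀ h, 0 < 1 - treePoly h rho) ∧
    Tendsto (fun h : ℕ => (h : ℝ)⁻¹ * (1 - treePoly h rho)⁻¹) atTop (𝓝 (1 / 2)) := by
  have hs2 := summable_of_le_rho (sq_nonneg rho) (sq_lt_rho rho_pos.le (by linarith)).le
  have hd : ∀ h, 0 ≤ (treeSeries (rho ^ 2) - treePoly h (rho ^ 2)) / 2 := fun h =>
    div_nonneg (sub_nonneg.2 (treePoly_le_treeSeries (sq_nonneg _) hs2 h)) zero_le_two
  have hrec : ∀ h, 1 - treePoly (h + 1) rho = (1 - treePoly h rho) - (1 - treePoly h rho) ^ 2 / 2 +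
      (treeSeries (rho ^ 2) - treePoly h (rho ^ 2)) / 2 := by
    intro h
    have h0 : 1 - 2 * rho - treeSeries (rho ^ 2) = 0 := discr_rho
    rw [treePoly_succ]
    linear_combination (1 / 2 : ℝ) * h0
  have hle : ∀ h, 1 - treePoly h rho ≤ 1 := fun h => by linarith [treePoly_nonneg rho_pos.le h]
  have hpos : ∀ h, 0 < 1 - treePoly h rho := by
    intro h
    induction h with
    | zero => rw [treePoly_zero]; linarith [rho_le_half]
    | succ h ih => rw [hrec]; nlinarith [hd h, hle h]
  refine ⟨hpos, tendsto_inv_div_of_recurrence hpos hle hrec hd (q := 1 / 2) (by norm_num)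
    (by norm_num) (fun h => ?_) ?_⟩
  · have h1 := norm_treeSeries_sub_treePoly_le (z := rho ^ 2) (q := 1 / 2) (s := rho) (by norm_num)
      (by norm_num) rho_pos.le (by
        rw [Real.norm_of_nonneg (sq_nonneg _)]; nlinarith [rho_le_half, rho_pos]) summable_rho h
    rw [treeSeries_rho, mul_one] at h1
    have h2 := (le_abs_self _).trans h1
    have h3 := hd h
    linarith
  · have h1 := tendsto_treePoly (z := rho) (by
      rw [Real.norm_of_nonneg rho_pos.le]; exact summable_rho)
    rw [treeSeries_rho] at h1
    simpa using h1.const_sub 1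

end NonPlaneTree

/-! ### The iteration in the variable `y ^ h / e`. -/

namespace NonPlaneTree

open Filter Topology Finset

/-- The geometric sum `1 + r + ⋯ + r ^ (h - 1)`. -/
noncomputable def geomSum {K : Type*} [Field K] (r : K) (h : ℕ) : K := ∑ i ∈ range h, r ^ i

section GeomSum

variable {K : Type*} [Field K]

theorem geomSum_succ (r : K) (h : ℕ) : geomSum r (h + 1) = geomSum r h + r ^ h :=
  sum_range_succ _ _

theorem one_sub_mul_geomSum (r : K) (h : ℕ) : (1 - r) * geomSum r h = 1 - r ^ h :=
  mul_neg_geom_sum r h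

theorem norm_geomSum_le (y : ℂ) (h : ℕ) : ‖geomSum y h‖ ≤ geomSum ‖y‖ h :=
  (norm_sum_le _ _).trans_eq (by simp [geomSum])

theorem geomSum_le {r : ℝ} (hr : 0 ≤ r) (hr1 : r ≤ 1) (h : ℕ) : geomSum r h ≤ h := by
  refine (sum_le_sum fun i _ => pow_le_one₀ hr hr1).trans_eq ?_
  simp

theorem one_sub_mul_geomSum_le {r : ℝ} (hr : 0 ≤ r) (h : ℕ) : (1 - r) * geomSum r h ≤ 1 := by
  rw [one_sub_mul_geomSum]
  linarith [pow_nonneg hr h]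

theorem geomSum_mono {r : ℝ} (hr : 0 ≤ r) : Monotone (geomSum r) :=
  monotone_nat_of_le_succ fun h => by
    rw [geomSum_succ]
    linarith [pow_nonneg hr h]

theorem one_le_geomSum {r : ℝ} (hr : 0 ≤ r) {h : ℕ} (hh : 1 ≤ h) : 1 ≤ geomSum r h := by
  simpa [geomSum] using geomSum_mono hr hh

theorem mul_pow_le_geomSum {r : ℝ} (hr : 0 ≤ r) (hr1 : r ≤ 1) (h : ℕ) :
    h * r ^ h ≤ geomSum r h := by
  have : ∑ i ∈ range h, r ^ h ≤ geomSum r h :=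
    sum_le_sum fun i hi => pow_le_pow_of_le_one hr hr1 (mem_range.1 hi).le
  simpa using this

/-- This is `1 - 1/x ≤ log x` at the ratio of consecutive sums, a ratio of at most `2`. The right
side telescopes, so the step errors sum to a logarithm. -/
theorem pow_div_geomSum_le_log {r : ℝ} (hr : 0 < r) (hr1 : r ≤ 1) {h : ℕ} (hh : 1 ≤ h) :
    r ^ h / geomSum r h ≤ 2 * (Real.log (geomSum r (h + 1)) - Real.log (geomSum r h)) := by
  have h1 := one_le_geomSum hr.le hh
  have h2 : r ^ h ≤ 1 := pow_le_one₀ hr.le hr1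
  have h3 : 0 < r ^ h := pow_pos hr h
  have h0 : 0 < geomSum r h := by linarith
  rw [geomSum_succ, ← Real.log_div (by positivity) (by positivity)]
  have h4 := Real.one_sub_inv_le_log_of_pos (x := (geomSum r h + r ^ h) / geomSum r h)
    (by positivity)
  rw [inv_div] at h4
  have h5 : r ^ h / geomSum r h ≤ 2 * (1 - geomSum r h / (geomSum r h + r ^ h)) := by
    rw [one_sub_div (by positivity), add_sub_cancel_left, ← mul_div_assoc,
      div_le_div_iff₀ h0 (by positivity)]
    nlinarith
  linarith

theorem geomSum_norm_le {y : ℂ} (hy : ‖y‖ < 1) (hκ : ‖1 - y‖ ≤ 4 * (1 - ‖y‖)) (h : ℕ) :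
    geomSum ‖y‖ h ≤ 4 * ‖geomSum y h‖ := by
  have h1 : (1 - ‖y‖) * geomSum ‖y‖ h ≤ ‖1 - y‖ * ‖geomSum y h‖ := by
    rw [one_sub_mul_geomSum, ← norm_mul, one_sub_mul_geomSum]
    simpa using norm_sub_norm_le (1 : ℂ) (y ^ h)
  have h2 : ‖1 - y‖ * ‖geomSum y h‖ ≤ 4 * (1 - ‖y‖) * ‖geomSum y h‖ := by gcongr
  have h3 : 0 < 1 - ‖y‖ := by linarith
  nlinarith

end GeomSum

/-- One step of the iteration `e' = y e - e ^ 2 / 2 + d` in terms of `y ^ h / e`. -/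
theorem norm_div_sub_div_le {y e e' d : ℂ} {h : ℕ} (hr : 15 / 16 ≤ ‖y‖) (hy : ‖y‖ < 1)
    (hκ : ‖1 - y‖ ≤ 4 * (1 - ‖y‖)) (he : e ≠ 0) (hrec : e' = y * e - e ^ 2 / 2 + d)
    (hd : ‖d‖ ≤ (3 / 4) ^ h) (hh : 2 * (h : ℝ) ^ 3 * (3 / 4) ^ h ≤ (7 / 8) ^ h)
    (hL : 4000 ≤ geomSum ‖y‖ h)
    (hD : ‖y ^ h / e - 1 / 2 * geomSum y h‖ ≤ geomSum ‖y‖ h / 16) :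
    e' ≠ 0 ∧ ‖y ^ (h + 1) / e' - y ^ h / e - y ^ h / 2‖ ≤ 250 * (‖y‖ ^ h / geomSum ‖y‖ h) := by
  have hy0 : y ≠ 0 := by rintro rfl; norm_num at hr
  have hS := geomSum_norm_le hy hκ h
  have hS' := norm_geomSum_le y h
  have hLh : geomSum ‖y‖ h ≤ h := geomSum_le (norm_nonneg y) hy.le h
  have hL1 : (1 - ‖y‖) * geomSum ‖y‖ h ≤ 1 := one_sub_mul_geomSum_le (norm_nonneg y) h
  set r := ‖y‖ with hrdef
  set L := geomSum r h with hLdef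
  set f := y ^ h / e with hf
  have hfe : f * e = y ^ h := div_mul_cancel₀ _ he
  have hhalf : ‖1 / 2 * geomSum y h‖ = ‖geomSum y h‖ / 2 := by
    rw [norm_mul]; norm_num; ring
  -- The main term has modulus at least `L/8` by the Stolz condition, and the deviation takes away
  -- at most `L/16`.
  have hf1 : L / 16 ≤ ‖f‖ := by
    have := norm_sub_norm_le (1 / 2 * geomSum y h) f
    rw [norm_sub_rev, hhalf] at this
    linarith
  have hf2 : ‖f‖ ≤ L := by
    have := norm_sub_norm_le f (1 / 2 * geomSum y h)
    rw [hhalf] at this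
    linarith
  have hL0 : 0 < L := by linarith
  have hr0 : 0 < r := by linarith
  have he0 : 0 < ‖e‖ := norm_pos_iff.2 he
  have hfe' : ‖f‖ * ‖e‖ = r ^ h := by rw [← norm_mul, hfe, norm_pow]
  have hrh : 0 < r ^ h := pow_pos hr0 h
  have hrh1 : r ^ h ≤ 1 := pow_le_one₀ hr0.le hy.le
  set t := r ^ h / L with ht
  have htL : t * L = r ^ h := div_mul_cancel₀ _ hL0.ne'
  have ht0 : 0 < t := div_pos hrh hL0
  have ht1 : t ≤ 1 / 4000 := by
    rw [ht, div_le_div_iff₀ hL0 (by norm_num)]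
    linarith
  have he1 : ‖e‖ ≤ 16 * t := by
    have : L * ‖e‖ ≤ 16 * r ^ h := by
      rw [← hfe']
      linarith [mul_le_mul_of_nonneg_right hf1 he0.le]
    rw [ht, ← mul_div_assoc, le_div_iff₀ hL0]
    linarith
  -- Here `r ^ 2 ≥ 7/8` because `r ≥ 15/16`, so `hh` makes `d` negligible against `r ^ (2 * h) / L ^
  -- 3`.
  have hde : ‖d‖ * L ^ 2 ≤ 3 / 4 * (r ^ h * ‖e‖) := by
    have h1 : (7 / 8 : ℝ) ^ h ≤ (r ^ 2) ^ h := by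
      gcongr
      nlinarith
    have h2 : L ^ 3 ≤ (h : ℝ) ^ 3 := by gcongr
    have h3 : 2 * (‖d‖ * L ^ 3) ≤ (r ^ h) ^ 2 := by
      calc 2 * (‖d‖ * L ^ 3) ≤ 2 * ((3 / 4) ^ h * (h : ℝ) ^ 3) := by gcongr
        _ = 2 * (h : ℝ) ^ 3 * (3 / 4) ^ h := by ring
        _ ≤ (r ^ 2) ^ h := hh.trans h1
        _ = (r ^ h) ^ 2 := by rw [← pow_mul, ← pow_mul, mul_comm]
    have h4 : (r ^ h) ^ 2 ≤ L * (r ^ h * ‖e‖) := by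
      calc (r ^ h) ^ 2 = ‖f‖ * (r ^ h * ‖e‖) := by rw [sq]; nth_rw 1 [← hfe']; ring
        _ ≤ _ := by gcongr
    have h5 : 2 * (‖d‖ * L ^ 2) ≤ r ^ h * ‖e‖ := by
      refine le_of_mul_le_mul_left ?_ hL0
      calc L * (2 * (‖d‖ * L ^ 2)) = 2 * (‖d‖ * L ^ 3) := by ring
        _ ≤ _ := h3.trans h4
    linarith [mul_pos hrh he0]
  set a := e / (2 * y) with ha
  set b := d / (y * e) with hb
  have ha1 : ‖a‖ ≤ 9 * t := by
    rw [ha, norm_div, norm_mul, Complex.norm_ofNat, div_le_iff₀ (by positivity)]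
    linarith [mul_le_mul_of_nonneg_left hr ht0.le]
  have hb1 : ‖b‖ * L ≤ t := by
    rw [hb, norm_div, norm_mul, div_mul_eq_mul_div, div_le_iff₀ (by positivity), ht,
      div_mul_eq_mul_div, le_div_iff₀ hL0]
    calc ‖d‖ * L * L = ‖d‖ * L ^ 2 := by ring
      _ ≤ 3 / 4 * (r ^ h * ‖e‖) := hde
      _ ≤ ‖y‖ * (r ^ h * ‖e‖) := by
        gcongr
        linarith
      _ = _ := by ring
  have hb2 : ‖b‖ ≤ t := by
    linarith [mul_le_mul_of_nonneg_left hL (norm_nonneg b), norm_nonneg b]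
  have hu : ‖a - b‖ ≤ 10 * t := (norm_sub_le a b).trans (by linarith)
  have hu1 : 1 / 2 ≤ ‖1 - (a - b)‖ := by
    have := norm_sub_norm_le 1 (a - b)
    rw [norm_one] at this
    linarith
  have hu0 : 1 - (a - b) ≠ 0 := norm_pos_iff.1 (by linarith)
  have he' : e' = y * e * (1 - (a - b)) := by
    rw [hrec, ha, hb]
    field_simp
    ring
  refine ⟨he' ▸ mul_ne_zero (mul_ne_zero hy0 he) hu0, ?_⟩
  -- Expansion of `f / (1 - u)` to second order with `u = a - b`; the linear term `f * a` is `y ^ h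
  -- / (2 * y)`, which is `y ^ h / 2` up to the first summand.
  have hkey : y ^ (h + 1) / e' - y ^ h / e - y ^ h / 2 =
      y ^ h * (1 - y) / (2 * y) - f * b + f * (a - b) ^ 2 / (1 - (a - b)) := by
    have h1 : y ^ (h + 1) / e' = f / (1 - (a - b)) := by
      rw [he', hf, pow_succ]
      field_simp
    have h2 : y ^ h * (1 - y) / (2 * y) = f * a - y ^ h / 2 := by
      rw [ha, ← hfe]
      field_simp
    rw [h1, h2, ← hf]
    field_simp
    ring
  rw [hkey]
  have hk1 : ‖y ^ h * (1 - y) / (2 * y)‖ ≤ 3 * t := by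
    rw [norm_div, norm_mul, norm_mul, norm_pow, Complex.norm_ofNat, ← hrdef,
      div_le_iff₀ (by positivity)]
    have h1 : (1 - r) * r ^ h ≤ t := by
      rw [← htL]
      linarith [mul_le_mul_of_nonneg_left hL1 ht0.le]
    calc r ^ h * ‖1 - y‖ ≤ r ^ h * (4 * (1 - r)) := by gcongr
      _ ≤ 4 * t := by linarith
      _ ≤ 3 * t * (2 * r) := by linarith [mul_le_mul_of_nonneg_left hr ht0.le]
  have hk2 : ‖f * b‖ ≤ t := by
    rw [norm_mul]
    calc ‖f‖ * ‖b‖ ≤ L * ‖b‖ := by gcongr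
      _ ≤ t := by linarith
  have hk3 : ‖f * (a - b) ^ 2 / (1 - (a - b))‖ ≤ 200 * t := by
    rw [norm_div, norm_mul, norm_pow, div_le_iff₀ (by linarith)]
    calc ‖f‖ * ‖a - b‖ ^ 2 ≤ L * (10 * t) ^ 2 := by gcongr
      _ = 100 * t * (t * L) := by ring
      _ ≤ 100 * t * 1 := by
        rw [htL]
        gcongr
      _ ≤ _ := by linarith [mul_le_mul_of_nonneg_left hu1 ht0.le]
  calc _ ≤ ‖y ^ h * (1 - y) / (2 * y)‖ + ‖f * b‖ + ‖f * (a - b) ^ 2 / (1 - (a - b))‖ :=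
        (norm_add_le _ _).trans (add_le_add_left (norm_sub_le _ _) _)
    _ ≤ _ := by linarith

/-- Long-time control of the iteration `e (h + 1) = y e h - e h ^ 2 / 2 + d h`, started at a late
enough time `h₀`. -/
theorem iterate_bounds {y : ℂ} {e d : ℕ → ℂ} {h₀ : ℕ} (hr : 15 / 16 ≤ ‖y‖) (hy : ‖y‖ < 1)
    (hκ : ‖1 - y‖ ≤ 4 * (1 - ‖y‖)) (hrec : ∀ h, e (h + 1) = y * e h - e h ^ 2 / 2 + d h)
    (hd : ∀ h, ‖d h‖ ≤ (3 / 4) ^ h)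
    (hh₀ : ∀ h : ℕ, h₀ ≤ h → 2 * (h : ℝ) ^ 3 * (3 / 4) ^ h ≤ (7 / 8) ^ h)
    (hL : 4000 ≤ geomSum ‖y‖ h₀) (he : e h₀ ≠ 0)
    (hD : ‖y ^ h₀ / e h₀ - 1 / 2 * geomSum y h₀‖ ≤ geomSum ‖y‖ h₀ / 16) :
    ∀ h, h₀ ≤ h → e h ≠ 0 ∧
      ‖y ^ h / e h - 1 / 2 * geomSum y h‖ ≤
        geomSum ‖y‖ h₀ / 16 + 500 * Real.log (geomSum ‖y‖ h) ∧
      ‖y ^ (h + 1) / e (h + 1) - y ^ h / e h - y ^ h / 2‖ ≤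
        250 * (‖y‖ ^ h / geomSum ‖y‖ h) := by
  have hr0 : 0 < ‖y‖ := by linarith
  have hpos : 1 ≤ h₀ := by
    by_contra! h0
    obtain rfl : h₀ = 0 := by omega
    simp only [geomSum, range_zero, sum_empty] at hL
    norm_num at hL
  have hLh : ∀ h, h₀ ≤ h → 4000 ≤ geomSum ‖y‖ h := fun h hh =>
    hL.trans (geomSum_mono (norm_nonneg y) hh)
  have hlog₀ : 0 ≤ Real.log (geomSum ‖y‖ h₀) := Real.log_nonneg (by linarith)
  have main : ∀ h, h₀ ≤ h → e h ≠ 0 ∧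
      ‖y ^ h / e h - 1 / 2 * geomSum y h‖ ≤ geomSum ‖y‖ h / 16 ∧
      ‖y ^ h / e h - 1 / 2 * geomSum y h‖ ≤
        geomSum ‖y‖ h₀ / 16 + 500 * Real.log (geomSum ‖y‖ h) := by
    intro h hh
    induction h, hh using Nat.le_induction with
    | base => exact ⟨he, hD, by linarith⟩
    | succ h hh ih =>
      obtain ⟨ih1, ih2, ih3⟩ := ih
      obtain ⟨hs1, hs2⟩ := norm_div_sub_div_le hr hy hκ ih1 (hrec h) (hd h) (hh₀ h hh) (hLh h hh) ih2
      have htri : ‖y ^ (h + 1) / e (h + 1) - 1 / 2 * geomSum y (h + 1)‖ ≤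
          ‖y ^ h / e h - 1 / 2 * geomSum y h‖ + 250 * (‖y‖ ^ h / geomSum ‖y‖ h) := by
        refine le_trans (le_of_eq ?_) ((norm_add_le _ _).trans (add_le_add_right hs2 _))
        rw [geomSum_succ]
        congr 1
        ring
      have hL0 := hLh h hh
      have hpow : 0 < ‖y‖ ^ h := pow_pos hr0 h
      refine ⟨hs1, ?_, ?_⟩
      -- The threshold `4000 = 250 * 16` makes one step's error at most the growth of `geomSum ‖y‖ h
      -- / 16`, so the deviation bound reproduces itself.
      · have : 250 * (‖y‖ ^ h / geomSum ‖y‖ h) ≤ ‖y‖ ^ h / 16 := by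
          rw [← mul_div_assoc, div_le_div_iff₀ (by linarith) (by norm_num)]
          nlinarith
        rw [geomSum_succ ‖y‖]
        linarith
      · have := pow_div_geomSum_le_log hr0 hy.le (hpos.trans hh)
        linarith
  intro h hh
  obtain ⟨h1, h2, h3⟩ := main h hh
  exact ⟨h1, h3,
    (norm_div_sub_div_le hr hy hκ h1 (hrec h) (hd h) (hh₀ h hh) (hLh h hh) h2).2⟩

end NonPlaneTree

/-! ### The discriminant near the closed disc and the continuation by a square root. -/

namespace NonPlaneTree

open Filter Topology

/-- Nonnegative coefficients bound the real part of `y(z^2)` by `y(rho^2) = 1 - 2 rho`. This yields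
both positivity on the disc and a derivative of at most `-2` at `rho`. -/
theorem two_mul_sub_le_re_discr {z : ℂ} (hz : ‖z‖ ≤ rho) : 2 * (rho - z.re) ≤ (discr z).re := by
  have hsq : ‖z ^ 2‖ ≤ rho ^ 2 := by
    rw [norm_pow]
    gcongr
  have hrho : rho ^ 2 < rho := sq_lt_rho rho_pos.le (by linarith)
  have h1 : ‖treeSeries (z ^ 2)‖ ≤ treeSeries (rho ^ 2) := by
    refine (norm_treeSeries_le (summable_of_le_rho (norm_nonneg _) (hsq.trans hrho.le))).trans ?_
    refine Summable.tsum_le_tsum (fun n => ?_)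
      (summable_of_le_rho (norm_nonneg _) (hsq.trans hrho.le))
      (summable_of_le_rho (sq_nonneg _) hrho.le)
    gcongr
  have h2 : 1 - 2 * rho - treeSeries (rho ^ 2) = 0 := discr_rho
  have h3 := (Complex.re_le_norm _).trans h1
  have h4 : (discr z).re = 1 - 2 * z.re - (treeSeries (z ^ 2)).re := by
    simp [discr]
  linarith

theorem re_discr_pos {z : ℂ} (hz : ‖z‖ ≤ rho) (hz' : z ≠ rho) : 0 < (discr z).re := by
  refine lt_of_lt_of_le ?_ (two_mul_sub_le_re_discr hz)
  have h1 : z.re ≤ rho := (Complex.re_le_norm z).trans hz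
  have h2 : z.re ≠ rho := by
    intro h
    refine hz' (Complex.ext (by simpa using h) ?_)
    have h3 := Complex.sq_norm_sub_sq_re z
    have h4 : ‖z‖ ^ 2 ≤ rho ^ 2 := by gcongr
    have h5 : z.im ^ 2 = 0 := by
      rw [h] at h3
      nlinarith [sq_nonneg z.im]
    simpa using h5
  have := lt_of_le_of_ne h1 h2
  linarith

theorem exists_hasDerivAt_discr :
    ∃ c : ℝ, 0 < c ∧ HasDerivAt (discr : ℂ → ℂ) (-c : ℂ) (rho : ℂ) := by
  have hd := (analyticAt_discr (z := (rho : ℂ))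
    (by simp [abs_of_pos rho_pos])).differentiableAt.hasDerivAt
  set a := deriv (discr : ℂ → ℂ) (rho : ℂ)
  have hre : HasDerivAt (discr : ℝ → ℝ) a.re rho := by
    simpa [discr_ofReal] using hd.real_of_complex
  have ha : a = (a.re : ℂ) := by
    have h1 : HasDerivAt (fun x : ℝ => ((discr x : ℝ) : ℂ)) a rho := by
      simpa only [discr_ofReal] using hd.comp_ofReal
    exact h1.unique hre.ofReal_comp
  have hneg : a.re ≤ -2 := by
    refine le_of_tendsto ((hasDerivAt_iff_tendsto_slope.1 hre).mono_left
      (nhdsWithin_mono rho (s := Set.Iio rho) (t := {rho}ᶜ) fun x hx => ne_of_lt hx)) ?_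
    filter_upwards [self_mem_nhdsWithin, mem_nhdsWithin_of_mem_nhds (lt_mem_nhds rho_pos)]
      with x hx hx0
    have hx : x < rho := hx
    have hx0 : 0 < x := hx0
    have h1 := two_mul_sub_le_re_discr (z := (x : ℂ)) (by simpa [abs_of_pos hx0] using hx.le)
    rw [discr_ofReal, Complex.ofReal_re, Complex.ofReal_re] at h1
    rw [slope_def_field, discr_rho, sub_zero, div_le_iff_of_neg (by linarith)]
    linarith
  refine ⟨-a.re, by linarith, ?_⟩
  rw [Complex.ofReal_neg, neg_neg, ← ha]
  exact hd

/-- Near `rho` the discriminant is close to a positive multiple of `rho - z`. -/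
theorem exists_discr_approx : ∃ c : ℝ, 0 < c ∧
    ∀ᶠ z : ℂ in 𝓝 (rho : ℂ), ‖discr z - c * (rho - z)‖ ≤ c / 8 * ‖(rho : ℂ) - z‖ := by
  obtain ⟨c, hc, hd⟩ := exists_hasDerivAt_discr
  refine ⟨c, hc, ?_⟩
  filter_upwards [(hasDerivAt_iff_isLittleO.1 hd).bound (by positivity : 0 < c / 8)] with z hz
  rw [discr_ofReal, discr_rho, norm_sub_rev z] at hz
  refine le_trans (le_of_eq ?_) hz
  congr 1
  simp only [Complex.ofReal_zero, smul_eq_mul]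
  ring

theorem re_le_mul_norm_of_lt_abs_arg {w : ℂ} {φ : ℝ} (hφ : 0 ≤ φ) (hw : φ ≤ |w.arg|) :
    w.re ≤ Real.cos φ * ‖w‖ := by
  rw [← Complex.norm_mul_cos_arg, ← Real.cos_abs, mul_comm]
  gcongr
  exact Real.cos_le_cos_of_nonneg_of_le_pi hφ (Complex.abs_arg_le_pi w) hw

/-- If `g` were on the cut, `w` would lie close to the negative axis, against `harg`. The `1/2` is
the cosine of the angle `π/3` of the domain. -/
theorem mem_slitPlane_of_approx {c : ℝ} (hc : 0 < c) {g w : ℂ} (hw : w ≠ 0)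
    (hg : ‖g - c * w‖ ≤ c / 8 * ‖w‖) (harg : -w.re ≤ 1 / 2 * ‖w‖) : g ∈ Complex.slitPlane := by
  by_contra hs
  rw [Complex.mem_slitPlane_iff] at hs
  push Not at hs
  obtain ⟨h1, h2⟩ := hs
  have h3 := (Complex.abs_re_le_norm _).trans hg
  have h4 := (Complex.abs_im_le_norm _).trans hg
  have hre : (g - c * w).re = g.re - c * w.re := by simp
  have him : (g - c * w).im = -(c * w.im) := by simp [h2]
  have hw0 : 0 < ‖w‖ := norm_pos_iff.2 hw
  rw [hre, abs_le] at h3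
  rw [him, abs_neg, abs_mul, abs_of_pos hc] at h4
  have h5 : |w.im| ≤ ‖w‖ / 8 := le_of_mul_le_mul_left (by linarith) hc
  have h6 : w.re ≤ ‖w‖ / 8 := le_of_mul_le_mul_left (by linarith) hc
  have h7 : |w.re| ≤ ‖w‖ / 2 := abs_le.2 ⟨by linarith, by linarith⟩
  have h8 := Complex.norm_le_abs_re_add_abs_im w
  linarith

/-- The set where the discriminant could meet the negative axis stays away from the closed disc of
radius `rho`, outside a neighbourhood of `rho`. -/
theorem exists_re_discr_pos {r : ℝ} (hr : 0 < r) :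
    ∃ ε : ℝ, 0 < ε ∧ ε ≤ 1 / 8 ∧ ∀ z : ℂ, ‖z‖ < rho + ε → r ≤ ‖z - rho‖ → 0 < (discr z).re := by
  set B := Metric.closedBall (0 : ℂ) (rho + 1 / 8)
  have hcont : ContinuousOn (fun z : ℂ => (discr z).re) B := fun z hz =>
    (Complex.continuous_re.continuousAt.comp
      (analyticAt_discr (by simpa [B] using hz)).continuousAt).continuousWithinAt
  set F := (B ∩ (fun z : ℂ => (discr z).re) ⁻¹' Set.Iic 0) ∩ {z : ℂ | r ≤ ‖z - rho‖}
  have hF : IsCompact F := by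
    refine (isCompact_closedBall (0 : ℂ) (rho + 1 / 8)).of_isClosed_subset
      ((hcont.preimage_isClosed_of_isClosed Metric.isClosed_closedBall isClosed_Iic).inter
        (isClosed_le continuous_const (by fun_prop))) fun z hz => hz.1.1
  rcases F.eq_empty_or_nonempty with hempty | hne
  · refine ⟨1 / 8, by norm_num, le_rfl, fun z hz hzr => ?_⟩
    by_contra! hle
    have : z ∈ F := ⟨⟨by simpa [B] using hz.le, hle⟩, hzr⟩
    rw [hempty] at this
    exact this
  · obtain ⟨z₀, hz₀, hmin⟩ := hF.exists_isMinOn hne continuous_norm.continuousOn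
    have h0 : rho < ‖z₀‖ := by
      by_contra! hle
      refine absurd (re_discr_pos hle fun h => ?_) (not_lt.2 hz₀.1.2)
      have := hz₀.2
      simp only [h, Set.mem_ofPred_eq, sub_self, norm_zero] at this
      linarith
    refine ⟨min (1 / 8) (‖z₀‖ - rho), lt_min (by norm_num) (by linarith), min_le_left _ _,
      fun z hz hzr => ?_⟩
    by_contra! hle
    have h1 := min_le_left (1 / 8) (‖z₀‖ - rho)
    have h2 := min_le_right (1 / 8) (‖z₀‖ - rho)
    have h3 : z ∈ F := ⟨⟨by simp only [B, mem_closedBall_zero_iff]; linarith, hle⟩, hzr⟩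
    have h4 : ‖z₀‖ ≤ ‖z‖ := hmin h3
    linarith

/-- The continuation of the generating function of all trees, by the quadratic formula. -/
noncomputable def treeGF (z : ℂ) : ℂ := 1 - discr z ^ (2⁻¹ : ℂ)

theorem one_sub_treeGF_sq (z : ℂ) : (1 - treeGF z) ^ 2 = discr z := by
  rw [treeGF, sub_sub_cancel]
  exact Complex.cpow_ofNat_inv_pow (discr z) 2

theorem analyticAt_treeGF {z : ℂ} (hz : ‖z‖ ≤ rho + 1 / 8) (hs : discr z ∈ Complex.slitPlane) :
    AnalyticAt ℂ treeGF z :=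
  analyticAt_const.sub ((analyticAt_discr hz).cpow analyticAt_const hs)

theorem treeGF_eq_treeSeries {z : ℂ} (hz : ‖z‖ < rho) : treeGF z = treeSeries z := by
  have hs := summable_of_lt_rho (norm_nonneg z) hz
  have h1 : (treeSeries z).re < 1 := (Complex.re_le_norm _).trans_lt
    ((norm_treeSeries_le hs).trans_lt (treeSeries_lt_one (norm_nonneg z) hz))
  rw [treeGF, ← one_sub_treeSeries_sq (by linarith [rho_le_half]) hs,
    Complex.sq_cpow_two_inv (by simpa using h1), sub_sub_cancel]

theorem treeGF_rho : treeGF (rho : ℂ) = 1 := by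
  simp [treeGF, discr_ofReal, discr_rho]

theorem continuousAt_treeGF : ContinuousAt treeGF (rho : ℂ) := by
  refine continuousAt_const.sub (ContinuousAt.comp (g := fun x : ℂ => x ^ (2⁻¹ : ℂ)) ?_
    (analyticAt_discr (by simp [abs_of_pos rho_pos])).continuousAt)
  exact Complex.continuousAt_cpow_const_of_re_pos (Or.inl (by simp [discr_ofReal, discr_rho]))
    (by norm_num)

theorem exists_isTreeGF : ∃ ε : ℝ, 0 < ε ∧ IsTreeGF treeGF ε (Real.pi / 3) := by
  obtain ⟨c, hc, happ⟩ := exists_discr_approx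
  obtain ⟨r, hr, hball⟩ := Metric.eventually_nhds_iff.1 happ
  obtain ⟨ε, hε, hε', hpos⟩ := exists_re_discr_pos hr
  refine ⟨ε, hε, fun z hz => analyticAt_treeGF (by linarith [hz.1]) ?_, fun z hz => ?_⟩
  · rcases lt_or_ge ‖z - rho‖ r with h | h
    · refine mem_slitPlane_of_approx hc (sub_ne_zero.2 hz.2.1.symm)
        (hball (by rwa [dist_eq_norm])) ?_
      have := re_le_mul_norm_of_lt_abs_arg (by positivity) hz.2.2.le
      rw [Real.cos_pi_div_three, norm_sub_rev] at this
      simpa using this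
    · exact Complex.mem_slitPlane_iff.2 (Or.inl (hpos z hz.1 h))
  · rw [treeGF_eq_treeSeries hz]
    exact (summable_treeCount (summable_of_lt_rho (norm_nonneg z) hz)).hasSum

/-- In a thin sandclock the values of the generating function stay in a Stolz angle at `1`. -/
theorem norm_treeGF_lt_one {c : ℝ} (hc : 0 < c) {z : ℂ} (hz : z ≠ rho)
    (happ : ‖discr z - c * (rho - z)‖ ≤ c / 8 * ‖(rho : ℂ) - z‖)
    (harg : (z - rho).re ≤ 1 / 8 * ‖z - rho‖) (hsmall : ‖1 - treeGF z‖ ≤ 1 / 16) :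
    ‖treeGF z‖ < 1 ∧ ‖1 - treeGF z‖ ≤ 4 * (1 - ‖treeGF z‖) := by
  set w := (rho : ℂ) - z with hw
  have hw0 : 0 < ‖w‖ := norm_pos_iff.2 (sub_ne_zero.2 hz.symm)
  rw [show z - rho = -w by rw [hw]; ring, norm_neg, Complex.neg_re] at harg
  have hcw : ‖(c : ℂ) * w‖ = c * ‖w‖ := by
    rw [norm_mul, Complex.norm_real, Real.norm_of_nonneg hc.le]
  have h1 : c * (7 / 8) * ‖w‖ ≤ ‖discr z‖ := by
    have := norm_sub_norm_le ((c : ℂ) * w) (discr z)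
    rw [norm_sub_rev, hcw] at this
    linarith
  have h2 : -(c / 4) * ‖w‖ ≤ (discr z).re := by
    have h3 := (abs_le.1 ((Complex.abs_re_le_norm _).trans happ)).1
    have h4 : (discr z - c * w).re = (discr z).re - c * w.re := by simp
    have h5 := mul_le_mul_of_nonneg_left harg hc.le
    linarith
  have hcw0 := mul_pos hc hw0
  -- For the principal root this amounts to `|D|/2 + Re D ≥ 0` with `D = discr z`, which holds since
  -- `7/16 > 1/4`.
  have hre : ‖1 - treeGF z‖ / 2 ≤ (1 - treeGF z).re := by
    rw [show (1 - treeGF z).re = √((‖discr z‖ + (discr z).re) / 2) by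
      rw [treeGF, sub_sub_cancel, Complex.cpow_inv_two_re]]
    refine Real.le_sqrt_of_sq_le ?_
    rw [div_pow, ← norm_pow, one_sub_treeGF_sq]
    linarith
  have hpos : 0 < ‖1 - treeGF z‖ := by
    rw [norm_pos_iff, ← pow_ne_zero_iff two_ne_zero, one_sub_treeGF_sq, ← norm_pos_iff]
    linarith
  set s := 1 - treeGF z with hs
  have hy : treeGF z = 1 - s := by rw [hs]; ring
  have hbound : ‖treeGF z‖ ≤ 1 - ‖s‖ / 4 := by
    refine (sq_le_sq₀ (norm_nonneg _) (by linarith)).1 ?_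
    have h6 : ‖treeGF z‖ ^ 2 = 1 - 2 * s.re + ‖s‖ ^ 2 := by
      rw [hy, Complex.sq_norm, Complex.sq_norm, Complex.normSq_apply, Complex.normSq_apply]
      simp only [Complex.sub_re, Complex.one_re, Complex.sub_im, Complex.one_im]
      ring
    rw [h6]
    nlinarith
  constructor <;> linarith

/-! ### Starting the iteration near `rho` and bounding the remainder. -/

theorem treePoly_continuous (h : ℕ) : Continuous fun z : ℂ => treePoly h z := by
  unfold treePoly
  fun_prop

theorem genGT_succ (h : ℕ) (z : ℂ) :
    genGT treeGF (h + 1) z = treeGF z * genGT treeGF h z - genGT treeGF h z ^ 2 / 2 +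
      (treeSeries (z ^ 2) - treePoly h (z ^ 2)) / 2 := by
  have h1 := one_sub_treeGF_sq z
  rw [discr] at h1
  simp only [genGT, genLE_eq_treePoly, treePoly_succ]
  linear_combination (-1 / 2 : ℂ) * h1

theorem genGT_rho (h : ℕ) : genGT treeGF h (rho : ℂ) = (1 - treePoly h rho : ℝ) := by
  rw [genGT, genLE_eq_treePoly, treeGF_rho, treePoly_ofReal]
  push_cast
  rfl

theorem continuousAt_genGT (h : ℕ) : ContinuousAt (genGT treeGF h) (rho : ℂ) :=
  continuousAt_treeGF.sub (treePoly_continuous h).continuousAt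

theorem genGT_rho_ne_zero (h : ℕ) : genGT treeGF h (rho : ℂ) ≠ 0 := by
  rw [genGT_rho]
  exact_mod_cast (tendsto_inv_one_sub_treePoly_rho.1 h).ne'

/-- The remainder with the fraction `(1 - y ^ h) / (1 - y)` written as a sum. -/
noncomputable def remainderSum (h : ℕ) (z : ℂ) : ℂ :=
  treeGF z ^ h / genGT treeGF h z - 1 / 2 * geomSum (treeGF z) h

theorem remainder_eq {z : ℂ} (hz : treeGF z ≠ 1) (h : ℕ) :
    remainder treeGF h z = remainderSum h z := by
  rw [remainder, remainderSum, ← one_sub_mul_geomSum,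
    mul_div_cancel_left₀ _ (sub_ne_zero.2 hz.symm)]

/-- The sum form has no singularity at `y = 1`, so bounds at `rho` for finitely many heights pass to
a neighbourhood. -/
theorem continuousAt_remainderSum (h : ℕ) : ContinuousAt (remainderSum h) (rho : ℂ) := by
  refine ((continuousAt_treeGF.pow h).div (continuousAt_genGT h) (genGT_rho_ne_zero h)).sub
    (continuousAt_const.mul ?_)
  unfold geomSum
  exact tendsto_finsetSum _ fun i _ => continuousAt_treeGF.pow i

theorem remainderSum_succ_sub (h : ℕ) (z : ℂ) :
    remainderSum (h + 1) z - remainderSum h z = treeGF z ^ (h + 1) / genGT treeGF (h + 1) z -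
      treeGF z ^ h / genGT treeGF h z - treeGF z ^ h / 2 := by
  rw [remainderSum, remainderSum, geomSum_succ]
  ring

theorem remainderSum_rho (h : ℕ) :
    remainderSum h (rho : ℂ) = ((1 - treePoly h rho)⁻¹ - h / 2 : ℝ) := by
  rw [remainderSum, genGT_rho, treeGF_rho]
  simp [geomSum]
  ring

/-- A time from which on the iteration is controlled near `rho`. -/
theorem exists_start : ∃ h₀ : ℕ, 4001 ≤ h₀ ∧
    (∀ h : ℕ, h₀ ≤ h → 2 * (h : ℝ) ^ 3 * (3 / 4) ^ h ≤ (7 / 8) ^ h) ∧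
    ‖remainderSum h₀ (rho : ℂ)‖ < h₀ / 16 := by
  have h1 : ∀ᶠ h : ℕ in atTop, 2 * (h : ℝ) ^ 3 * (3 / 4) ^ h ≤ (7 / 8) ^ h := by
    have := tendsto_pow_const_mul_const_pow_of_lt_one 3 (r := 6 / 7) (by norm_num) (by norm_num)
    filter_upwards [this.eventually (gt_mem_nhds (by norm_num : (0 : ℝ) < 1 / 2))] with h hh
    rw [show (3 / 4 : ℝ) = 6 / 7 * (7 / 8) by norm_num, mul_pow]
    have h78 : (0 : ℝ) < (7 / 8) ^ h := by positivity
    nlinarith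
  have h2 : ∀ᶠ h : ℕ in atTop, ‖remainderSum h (rho : ℂ)‖ < h / 16 := by
    filter_upwards [tendsto_inv_one_sub_treePoly_rho.2.eventually
      (Metric.ball_mem_nhds _ (by norm_num : (0 : ℝ) < 1 / 16)), eventually_ge_atTop 1] with h hh h0
    have hpos : (0 : ℝ) < h := by exact_mod_cast h0
    rw [remainderSum_rho, Complex.norm_real]
    rw [Real.dist_eq] at hh
    have : (1 - treePoly h rho)⁻¹ - h / 2 = h * ((h : ℝ)⁻¹ * (1 - treePoly h rho)⁻¹ - 1 / 2) := by
      rw [mul_sub, mul_inv_cancel_left₀ hpos.ne']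
      ring
    rw [this, norm_mul, Real.norm_of_nonneg hpos.le, Real.norm_eq_abs]
    nlinarith
  obtain ⟨N, hN⟩ := eventually_atTop.1 h1
  obtain ⟨h₀, hh, hN', h4⟩ := (h2.and ((eventually_ge_atTop N).and (eventually_ge_atTop 4001))).exists
  exact ⟨h₀, h4, fun h hle => hN h (hN'.trans hle), hh⟩

/-- Control of the remainder for all heights, from its control up to a late enough time `h₀`. -/
theorem remainderSum_bounds {z : ℂ} {h₀ : ℕ} {M : ℝ} (hM0 : 0 < M)
    (hexp : ∀ h : ℕ, h₀ ≤ h → 2 * (h : ℝ) ^ 3 * (3 / 4) ^ h ≤ (7 / 8) ^ h)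
    (hfin : ∀ h ∈ Finset.range (h₀ + 1), genGT treeGF h z ≠ 0 ∧ ‖remainderSum h z‖ < M)
    (hgeom : 4000 < geomSum ‖treeGF z‖ h₀)
    (hD : ‖remainderSum h₀ z‖ < geomSum ‖treeGF z‖ h₀ / 16) (hsmall : ‖1 - treeGF z‖ < 1 / 16)
    (hnorm : ‖z ^ 2‖ < 3 / 4 * rho) (hy : ‖treeGF z‖ < 1)
    (hκ : ‖1 - treeGF z‖ ≤ 4 * (1 - ‖treeGF z‖)) {h : ℕ} (hh : 1 ≤ h) :
    genGT treeGF h z ≠ 0 ∧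
      ‖remainderSum h z‖ ≤ M + h₀ + 250 + 2 * M * h₀ + 500 * Real.log (geomSum ‖treeGF z‖ h) ∧
      ‖remainderSum (h + 1) z - remainderSum h z‖ ≤ (M + h₀ + 250 + 2 * M * h₀) / h := by
  have hh₀ : (0 : ℝ) ≤ h₀ := Nat.cast_nonneg _
  have hr : 15 / 16 ≤ ‖treeGF z‖ := by
    have := norm_sub_norm_le 1 (treeGF z)
    rw [norm_one] at this
    linarith
  have hd : ∀ h, ‖(treeSeries (z ^ 2) - treePoly h (z ^ 2)) / 2‖ ≤ (3 / 4) ^ h := by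
    intro h
    have h1 := norm_treeSeries_sub_treePoly_le (q := 3 / 4) (by norm_num) (by norm_num) rho_pos.le
      hnorm.le summable_rho h
    rw [treeSeries_rho, mul_one] at h1
    rw [norm_div, Complex.norm_ofNat]
    linarith [norm_nonneg (treeSeries (z ^ 2) - treePoly h (z ^ 2))]
  have hiter := iterate_bounds (e := fun h => genGT treeGF h z) hr hy hκ
    (fun h => genGT_succ h z) hd
    hexp hgeom.le (hfin h₀ (by simp)).1 hD.le
  have hpos : (0 : ℝ) < h := by exact_mod_cast hh
  have hL1 := one_le_geomSum (norm_nonneg (treeGF z)) hh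
  have hlog := Real.log_nonneg hL1
  have hMh : 0 ≤ 2 * M * h₀ := by positivity
  -- Below `h₀` the uniform bound `M` suffices, with `2 * M * h₀ / h` absorbing the difference; from
  -- `h₀` on the iteration takes over.
  rcases lt_or_ge h h₀ with hlt | hge
  · obtain ⟨h1, h2⟩ := hfin h (by simp; omega)
    obtain ⟨-, h3⟩ := hfin (h + 1) (by simp; omega)
    refine ⟨h1, by linarith, (norm_sub_le _ _).trans ?_⟩
    rw [le_div_iff₀ hpos]
    have hlt' : (h : ℝ) ≤ h₀ := by exact_mod_cast hlt.le
    calc (‖remainderSum (h + 1) z‖ + ‖remainderSum h z‖) * h ≤ (2 * M) * h₀ := by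
          gcongr
          linarith
      _ ≤ _ := by linarith
  · obtain ⟨h1, h2, h3⟩ := hiter h hge
    have hLh₀ := geomSum_le (norm_nonneg (treeGF z)) hy.le h₀
    refine ⟨h1, h2.trans (by linarith), ?_⟩
    rw [remainderSum_succ_sub]
    refine h3.trans ?_
    rw [← mul_div_assoc, div_le_div_iff₀ (by linarith) hpos]
    calc 250 * ‖treeGF z‖ ^ h * h = 250 * (h * ‖treeGF z‖ ^ h) := by ring
      _ ≤ 250 * geomSum ‖treeGF z‖ h := by
        gcongr
        exact mul_pow_le_geomSum (norm_nonneg _) hy.le h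
      _ ≤ _ := by
        gcongr
        linarith

/-- Control of the remainder at every point close to `rho` where the generating function lies in a
Stolz angle at `1`. -/
theorem exists_remainder_bounds : ∃ A : ℝ, 0 < A ∧ ∀ᶠ z in 𝓝 (rho : ℂ),
    ‖1 - treeGF z‖ ≤ 1 / 16 ∧
    (‖treeGF z‖ < 1 → ‖1 - treeGF z‖ ≤ 4 * (1 - ‖treeGF z‖) → ∀ h : ℕ, 1 ≤ h →
      genGT treeGF h z ≠ 0 ∧
      ‖remainderSum h z‖ ≤ A + 500 * Real.log (geomSum ‖treeGF z‖ h) ∧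
      ‖remainderSum (h + 1) z - remainderSum h z‖ ≤ A / h) := by
  obtain ⟨h₀, h₀ge, hexp, hstart⟩ := exists_start
  obtain ⟨B, hB⟩ := ((Finset.range (h₀ + 1)).image fun h => ‖remainderSum h (rho : ℂ)‖).exists_le
  have hfin : ∀ᶠ z in 𝓝 (rho : ℂ), ∀ h ∈ Finset.range (h₀ + 1),
      genGT treeGF h z ≠ 0 ∧ ‖remainderSum h z‖ < |B| + 1 := by
    refine (eventually_all_finset _).2 fun h hh =>
      ((continuousAt_genGT h).eventually_ne (genGT_rho_ne_zero h)).and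
        ((continuousAt_remainderSum h).norm.eventually (gt_mem_nhds ?_))
    have := hB _ (Finset.mem_image_of_mem _ hh)
    linarith [le_abs_self B]
  have hgeom_rho : geomSum ‖treeGF (rho : ℂ)‖ h₀ = h₀ := by simp [treeGF_rho, geomSum]
  have hgeom_cont : ContinuousAt (fun z => geomSum ‖treeGF z‖ h₀) (rho : ℂ) := by
    unfold geomSum
    exact tendsto_finsetSum _ fun i _ => continuousAt_treeGF.norm.pow i
  have hgeom : ∀ᶠ z in 𝓝 (rho : ℂ), 4000 < geomSum ‖treeGF z‖ h₀ := by
    refine hgeom_cont.eventually (lt_mem_nhds ?_)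
    change 4000 < geomSum ‖treeGF (rho : ℂ)‖ h₀
    rw [hgeom_rho]
    have : (4001 : ℝ) ≤ h₀ := by exact_mod_cast h₀ge
    linarith
  have hD : ∀ᶠ z in 𝓝 (rho : ℂ), ‖remainderSum h₀ z‖ < geomSum ‖treeGF z‖ h₀ / 16 :=
    (continuousAt_remainderSum h₀).norm.eventually_lt (hgeom_cont.div_const 16)
      (by rw [hgeom_rho]; exact hstart)
  have hsmall : ∀ᶠ z in 𝓝 (rho : ℂ), ‖1 - treeGF z‖ < 1 / 16 :=
    (continuousAt_const.sub continuousAt_treeGF).norm.eventually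
      (gt_mem_nhds (by simp [treeGF_rho]))
  have hnorm : ∀ᶠ z in 𝓝 (rho : ℂ), ‖z ^ 2‖ < 3 / 4 * rho := by
    refine (continuous_norm.comp (continuous_pow 2)).continuousAt.eventually (gt_mem_nhds ?_)
    simp only [Function.comp_apply, norm_pow, Complex.norm_real, Real.norm_eq_abs, sq_abs]
    nlinarith [rho_le_half, rho_pos]
  set M := |B| + 1
  have hM0 : 0 < M := by positivity
  refine ⟨M + h₀ + 250 + 2 * M * h₀, by positivity, ?_⟩
  filter_upwards [hfin, hgeom, hD, hsmall, hnorm] with z hfin hgeom hD hsmall hnorm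
  exact ⟨hsmall.le, fun hy hκ h hh => remainderSum_bounds hM0 hexp hfin hgeom hD hsmall hnorm hy hκ hh⟩

/-! ### Passage to the sandclock and the final constants. -/

theorem sandclock_subset_deltaDomain {r₀ θ₀ ε : ℝ} (hr : r₀ ≤ ε) (hθ : θ₀ ≤ Real.pi / 6) :
    sandclock r₀ θ₀ ⊆ deltaDomain ε (Real.pi / 3) := by
  rintro z ⟨h1, h2, -⟩
  have harg : Real.pi / 3 < |(z - rho).arg| := by linarith
  refine ⟨?_, ?_, harg⟩
  · have := norm_sub_norm_le z (rho : ℂ)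
    rw [Complex.norm_real, Real.norm_of_nonneg rho_pos.le] at this
    linarith
  · rintro rfl
    rw [sub_self, Complex.arg_zero, abs_zero] at harg
    linarith [Real.pi_pos]

theorem le_mul_min_log {A r : ℝ} (hA : 0 ≤ A) {h : ℕ} (hh : 1 ≤ h) (hr : 15 / 16 ≤ r) (hr1 : r < 1) :
    A + 500 * Real.log (geomSum r h) ≤
      (2 * A + 500) * min (Real.log (1 / (1 - r))) (Real.log (1 + (h : ℝ))) := by
  have hr0 : 0 ≤ r := by linarith
  have hL1 := one_le_geomSum hr0 hh
  have hL0 : 0 < geomSum r h := by linarith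
  have h1r : 0 < 1 - r := by linarith
  have hh' : (1 : ℝ) ≤ h := by exact_mod_cast hh
  have h1 : Real.log (geomSum r h) ≤ min (Real.log (1 / (1 - r))) (Real.log (1 + (h : ℝ))) := by
    refine le_min (Real.log_le_log hL0 ?_) (Real.log_le_log hL0 ?_)
    · rw [le_div_iff₀ h1r, mul_comm]
      exact one_sub_mul_geomSum_le hr0 h
    · linarith [geomSum_le hr0 hr1.le h]
  -- Both logarithms are at least `log 2`, so the additive constant `A` is absorbed at the cost of
  -- `2 * A` in the factor.
  have h2 : 1 / 2 ≤ min (Real.log (1 / (1 - r))) (Real.log (1 + (h : ℝ))) := by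
    have hlog2 : 1 / 2 ≤ Real.log 2 := by linarith [Real.log_two_gt_d9]
    refine hlog2.trans (le_min (Real.log_le_log two_pos ?_) (Real.log_le_log two_pos (by linarith)))
    rw [le_div_iff₀ h1r]
    linarith
  nlinarith

end NonPlaneTree

open NonPlaneTree

theorem mainTheorem4 :
    ∃ (y : ℂ → ℂ) (ε φ : ℝ), 0 < ε ∧ 0 < φ ∧ φ < Real.pi / 2 ∧
      NonPlaneTree.IsTreeGF y ε φ ∧
      ∃ r₁ θ₁ K K' : ℝ, 0 < r₁ ∧ 0 < θ₁ ∧ θ₁ < Real.pi / 2 ∧ 0 < K ∧ 0 < K' ∧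
        NonPlaneTree.sandclock r₁ θ₁ ⊆ NonPlaneTree.deltaDomain ε φ ∧
        ∀ z ∈ NonPlaneTree.sandclock r₁ θ₁, ‖y z‖ < 1 ∧
          ∀ h : ℕ, 1 ≤ h →
            NonPlaneTree.genGT y h z ≠ 0 ∧
            ‖NonPlaneTree.remainder y h z‖ ≤
              K * min (Real.log (1 / (1 - ‖y z‖))) (Real.log (1 + (h : ℝ))) ∧
            ‖NonPlaneTree.remainder y h z - NonPlaneTree.remainder y (h + 1) z‖ < K' / (h : ℝ) := by
  obtain ⟨ε, hε, hGF⟩ := exists_isTreeGF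
  obtain ⟨c, hc, happ⟩ := exists_discr_approx
  obtain ⟨A, hA, hbounds⟩ := exists_remainder_bounds
  obtain ⟨r, hr, hball⟩ := Metric.eventually_nhds_iff.1 (happ.and hbounds)
  have hpi := Real.pi_gt_three
  have hsub : sandclock (min r ε) (1 / 8) ⊆ deltaDomain ε (Real.pi / 3) :=
    sandclock_subset_deltaDomain (min_le_right _ _) (by linarith)
  refine ⟨treeGF, ε, Real.pi / 3, hε, by positivity, by linarith, hGF, min r ε, 1 / 8,
    2 * A + 500, A + 1, lt_min hr hε, by norm_num, by linarith, by positivity, by positivity,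
    hsub, fun z hz => ?_⟩
  have hzρ : z ≠ rho := (hsub hz).2.1
  obtain ⟨happz, hsmall, hz'⟩ := hball
    (show dist z rho < r by rw [dist_eq_norm]; exact hz.1.trans_le (min_le_left _ _))
  -- The half-angle `1/8` is chosen so that its sine meets the `1/8` required by
  -- `norm_treeGF_lt_one`.
  have harg : (z - rho).re ≤ 1 / 8 * ‖z - rho‖ := by
    refine (re_le_mul_norm_of_lt_abs_arg (by linarith) hz.2.1.le).trans ?_
    rw [Real.cos_pi_div_two_sub]
    gcongr
    exact Real.sin_le (by norm_num)
  obtain ⟨hy, hκ⟩ := norm_treeGF_lt_one hc hzρ happz harg hsmall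
  have hy1 : treeGF z ≠ 1 := fun h => by simp [h] at hy
  have hr16 : 15 / 16 ≤ ‖treeGF z‖ := by
    have := norm_sub_norm_le 1 (treeGF z)
    rw [norm_one] at this
    linarith
  refine ⟨hy, fun h hh => ?_⟩
  obtain ⟨h1, h2, h3⟩ := hz' hy hκ h hh
  rw [remainder_eq hy1, remainder_eq hy1, norm_sub_rev]
  refine ⟨h1, h2.trans (le_mul_min_log hA.le hh hr16 hy), h3.trans_lt ?_⟩
  have hpos : (0 : ℝ) < h := by exact_mod_cast hh
  gcongr
  linarith
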